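/- **Lemma 6.2 (Main technical lemma).** Let $b\ge 2$ be an integer and $f(t)=\dfrac{4t^b}{(1+t^b)^2}$. Let $\Omega_0$ be the immediate basin of attraction of the superstable fixed point $0$ of $f$, $\Omega=\overline{\Omega_0}$ and $\Gamma=\partial\Omega_0$. Let $\psi:\Omega\to\overline{\mathbb D}$ be the homeomorphism onto the closed unit disk that is conformal on $\Omega_0$, satisfies $\psi(f(t))=\psi(t)^b$ and maps the real fixed point $t_c\in(0,1)$ of $f$ to $1$, and let $\mu$ be the harmonic measure on $\Gamma$, that is, the image under $\psi^{-1}$ of the normalized Lebesgue measure on the unit circle. Let $\Sigma_b=\{0,\dots,b-1\}^{\mathbb Z}$ with the Bernoulli measure $\overline\mu$ with $b$ equal states. For $r\in(0,1]$ and $\overline\varepsilon\in\Sigma_b$ put $$t_{-k}(r,\overline\varepsilon)=\psi^{-1}\!\left(r^{1/b^{k}}e^{2\pi i\theta_{k}}\right),\qquad \theta_{k}=\sum_{j\ge 0}\varepsilon_{j-k}\,b^{-j-1}\qquad(k\ge 0).$$ Then $(t_0,t_{-1},t_{-2},\dots)$ is an inverse orbit of $f$ in $\Omega$, that is, $f(t_{-k-1})=t_{-k}$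 for all $k\ge 0$; it is the point with coordinates $(r,\overline\varepsilon)$ of the natural extension of $f|\Omega$, and for fixed $r$ these coordinates carry $\overline\mu$ to the Bernoulli measure on the solenoid $\overline\Gamma_r$. Let $\beta$ be continuous on $\Omega$ and holomorphic in $\Omega_0$, without zeros on $\Gamma$, and with $\int_\Gamma\ln|\beta|\,d\mu>0$. For $h$ continuous on $\Omega$ and holomorphic in $\Omega_0$ let $$G(r,\overline\varepsilon)=-\sum_{k=1}^\infty\frac{h(t_{-k})}{\beta(t_{-1})\cdots\beta(t_{-k})},\qquad t_{-k}=t_{-k}(r,\overline\varepsilon),$$ the multivalued solution of $\beta(t)V(ft)-V(t)=-h(t)$. There is $\kappa_0>0$, depending only on $b$ and $\beta$, such that for every such $h$ the following holds. For $\overline\mu$-almost every $\overline\varepsilon$ and all $r\in(0,1]$, the denominators in the series for $G(r,\overline\varepsilon)$ do not vanish and the series converges absolutely. For every $\kappa\in(0,\kappa_0)$ and every $r\in(0,1]$, $G(r,\cdot)\in L^\kappa(\Sigma_b,\overline\mu)$, i.e. $G(r,\cdot)$ is $\overline\mu$-measurable and $$\int_{\Sigma_b}|G(r,\overline\varepsilon)|^\kappa\,d\overline\mu(\overline\varepsilon)<\infty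 .$$ Moreover, for every $\kappa\in(0,\kappa_0)$ and every $\delta>0$, the function $G_\delta(\overline\varepsilon)=\sup_{\delta\le r\le 1}|G(r,\overline\varepsilon)|\in[0,\infty]$ is $\overline\mu$-measurable and $\int_{\Sigma_b}G_\delta^\kappa\,d\overline\mu<\infty$. (The supremum over the empty set is $0$.) -/

import Mathlib

open Set Filter Topology MeasureTheory

namespace HierarchicalIsing

noncomputable section

/-- The Migdal--Kadanoff renormalization map `f(t) = 4 t^b / (1 + t^b)^2`.  At a pole Lean returns
the value `0`; since `f(∞) = 0` and `f(0) = 0`, this does not change the basin of `0` in `ℂ`. -/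
def f (b : ℕ) (t : ℂ) : ℂ := 4 * t ^ b / (1 + t ^ b) ^ 2

/-- The basin of attraction of the superstable fixed point `0`. -/
def basin (b : ℕ) : Set ℂ := {t | Tendsto (fun n : ℕ => (f b)^[n] t) atTop (𝓝 0)}

/-- The immediate basin `Ω₀` of `0`; its closure is `Ω` and its frontier is `Γ`. -/
def Omega0 (b : ℕ) : Set ℂ := connectedComponentIn (basin b) 0

/-- `φ` is the inverse `ψ⁻¹` of the Riemann map of `Ω₀` onto the unit disk, extended
continuously to the closed disk, that conjugates `z ↦ z^b` to `f` and is normalized by the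
condition that `φ(1)` is the real fixed point `t_c ∈ (0,1)`. These conditions determine `φ` on the
closed disk. -/
structure IsInverseRiemannMap (b : ℕ) (φ : ℂ → ℂ) : Prop where
  differentiableOn : DifferentiableOn ℂ φ (Metric.ball 0 1)
  continuousOn : ContinuousOn φ (Metric.closedBall 0 1)
  bijOn : BijOn φ (Metric.ball 0 1) (Omega0 b)
  map_zero : φ 0 = 0
  map_pow : ∀ z ∈ Metric.closedBall (0 : ℂ) 1, φ (z ^ b) = f b (φ z)
  map_one : ∃ tc ∈ Ioo (0 : ℝ) 1, φ 1 = tc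

/-- The map `ψ⁻¹` from the closed unit disk onto `Ω`. -/
def psiInv (b : ℕ) : ℂ → ℂ := Classical.epsilon (IsInverseRiemannMap b)

/-- The harmonic measure `μ` of `Ω₀` at `0`: the image under `ψ⁻¹` of the normalized Lebesgue
measure on the unit circle. It is also the measure of maximal entropy of `f` on `Γ`. -/
def harmonicMeasure (b : ℕ) : Measure ℂ :=
  Measure.map (fun θ : ℝ => psiInv b (Complex.exp (2 * Real.pi * θ * Complex.I)))
    (volume.restrict (Ico (0 : ℝ) 1))

/-- The Lyapunov exponent `χ_μ(β) = ∫ ln |β| dμ`. -/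
def lyapunov (b : ℕ) (β : ℂ → ℂ) : ℝ := ∫ t, Real.log ‖β t‖ ∂(harmonicMeasure b)

/-- The natural extension: the inverse orbits `(z₀, z₋₁, z₋₂, …)` of `f` in `Ω`; the point `z₋ₖ`
is written `z k`. -/
def naturalExtension (b : ℕ) : Set (ℕ → ℂ) :=
  {z | ∀ k, z k ∈ closure (Omega0 b) ∧ f b (z (k + 1)) = z k}

/-- The two-sided sequence space `Σ_b`. -/
abbrev BiSeq (b : ℕ) : Type := ℤ → Fin b

/-- The Bernoulli measure on `Σ_b` with `b` equal states. -/
def bernoulliMeasure (b : ℕ) : Measure (BiSeq b) :=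
  Measure.infinitePi (fun _ : ℤ => ProbabilityTheory.uniformOn (univ : Set (Fin b)))

/-- The point of the disk with symbolic coordinates `f̄⁻ᵏ(r, ε) = (r^(1/b^k), σ⁻ᵏ ε)`: its modulus is
`r^(1/b^k)` and its argument is `2πθ`, where `θ` has the `b`-adic digits `ε₋ₖ, ε₋ₖ₊₁, ε₋ₖ₊₂, …`. -/
def diskPoint (b : ℕ) (r : ℝ) (ε : BiSeq b) (k : ℕ) : ℂ :=
  ((r ^ (((b : ℝ) ^ k)⁻¹) : ℝ) : ℂ) *
    Complex.exp (2 * Real.pi * (Real.ofDigits (fun j : ℕ => ε ((j : ℤ) - k)) : ℝ) * Complex.I)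

/-- The inverse orbit `t̄ = (t₀, t₋₁, …)` on the solenoid `Γ̄_r` coded by `(r, ε)`. -/
def solenoidPoint (b : ℕ) (r : ℝ) (ε : BiSeq b) : ℕ → ℂ :=
  fun k => psiInv b (diskPoint b r ε k)

/-- The cocycle `β₋ₖ(t̄) = [β(t₋₁) ⋯ β(t₋ₖ)]⁻¹`. -/
def backCocycle (β : ℂ → ℂ) (z : ℕ → ℂ) (k : ℕ) : ℂ := (∏ j ∈ Finset.Icc 1 k, β (z j))⁻¹

/-- The `k`-th term `β₋ₖ(t̄) h(t₋ₖ)` of the series that defines `G`. -/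
def seriesTerm (β h : ℂ → ℂ) (z : ℕ → ℂ) (k : ℕ) : ℂ := backCocycle β z k * h (z k)

/-- The multivalued solution `G(t̄) = - ∑_{k ≥ 1} β₋ₖ(t̄) h(t₋ₖ)`. -/
def G (β h : ℂ → ℂ) (z : ℕ → ℂ) : ℂ := -∑' k : ℕ, seriesTerm β h z (k + 1)

/-- `G_δ(ε) = sup_{δ ≤ r ≤ 1} |G(r, ε)|`, with values in `[0, ∞]`. -/
def supG (b : ℕ) (β h : ℂ → ℂ) (δ : ℝ) (ε : BiSeq b) : ENNReal :=
  ⨆ r ∈ Icc δ 1, ‖G β h (solenoidPoint b r ε)‖ₑ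

end

end HierarchicalIsing

namespace HierarchicalIsing

open scoped ENNReal

/-! Uniformization. If `φ` conjugates `z ↦ z^b` to `f` and `φ z = z * exp (v z)`, then solving for
the preimage in `f` gives `v z = logBranch b (z^b) (v (z^b))`. On the half-plane `Re y ≤ log (1 -
σ^2)`, where `1 - σ^2` is the real fixed point, this branch is a contraction of ratio `1 / (b σ) <
1`. Its fixed point `v` yields `φ` on the closed disk (`exists_isInverseRiemannMap`), so `psiInv`
has the required properties and everything can be transported to `B = β ∘ psiInv` on the disk.

Decay. Under the Bernoulli measure the angles form a Markov chain: the next angle is a uniformly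
chosen inverse branch of `x ↦ b x mod 1`. Iterated branch averages converge uniformly to the mean,
so a function of positive mean becomes, after a coboundary correction `v`, positive on average over
the branches at every point. Hence for small `κ` the `κ`-moments of the inverse products decay
geometrically (`exists_exponential_contraction`, `lintegral_mul_exp_sum_angle_le`). For `r ≥ δ` this
applies to all points beyond some index `K = K(δ)`, since these lie close to the circle.

Zeros. `B` has no zero on the circle, so it is bounded below by powers of the distances to finitely
many points `a` of the open disk. The distance to `a ≠ 0` is at least the distance from `a` to the
line of the same angle, which does not depend on `r`; its negative powers of exponent less than `1`
are integrable. Moduli along an inverse orbit satisfy `|z_i| ≤ |z_j|^2` for `i < j`, so at most one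
orbit point is close to a given `a ≠ 0`. The exponent `M` in `exists_orbit_bounds` therefore does
not depend on `K`, and this is why `κ₀` depends neither on `δ` nor on `h`.

Conclusion. Since `x ↦ x^κ` is subadditive for `κ ≤ 1`, the term bounds, uniform in `r ≥ δ`, add up
to a bound for `|G|^κ` and for its supremum (`exists_majorant`). -/

/-! ### The inverse branch of `f` in logarithmic coordinates and its contraction -/

lemma sqrt_sq_eq (u : ℂ) : Complex.sqrt u ^ 2 = u := by
  simp [Complex.sqrt]

lemma le_re_sqrt {c : ℝ} {u : ℂ} (hu : c ^ 2 ≤ u.re) : c ≤ (Complex.sqrt u).re := by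
  rw [Complex.sqrt, Complex.cpow_inv_two_re]
  apply Real.le_sqrt_of_sq_le
  have := Complex.re_le_norm u
  linarith

/-- The inverse branch of `f` at the superattracting fixed point in logarithmic coordinates. -/
noncomputable def logBranch (b : ℕ) (x y : ℂ) : ℂ :=
  (y - 2 * Complex.log (1 + Complex.sqrt (1 - x * Complex.exp y))) / b

lemma hasDerivAt_complex_sqrt {u : ℂ} (hu : u ∈ Complex.slitPlane) :
    HasDerivAt Complex.sqrt (2 * Complex.sqrt u)⁻¹ u := by
  convert! Complex.hasDerivAt_sqrt hu using 1
  rw [show (-1 / 2 : ℂ) = -(2⁻¹) by norm_num, Complex.cpow_neg, Complex.sqrt, mul_inv]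
  ring

lemma hasDerivAt_logBranch {b : ℕ} (hb : b ≠ 0) {x y : ℂ}
    (h : 0 < (1 - x * Complex.exp y).re) :
    HasDerivAt (logBranch b x) (1 / (b * Complex.sqrt (1 - x * Complex.exp y))) y := by
  set u := 1 - x * Complex.exp y with hu
  have hs : 0 < (Complex.sqrt u).re := by
    have := le_re_sqrt (c := √u.re) (u := u) (by rw [Real.sq_sqrt h.le])
    exact (Real.sqrt_pos.2 h).trans_le this
  have hs0 : Complex.sqrt u ≠ 0 := fun h0 => by simp [h0] at hs
  have hs1 : 1 + Complex.sqrt u ≠ 0 := fun h0 => by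
    have := congrArg Complex.re h0
    simp at this
    linarith
  have h1 : HasDerivAt (fun y => 1 - x * Complex.exp y) (-(x * Complex.exp y)) y := by
    simpa using ((Complex.hasDerivAt_exp y).const_mul x).const_sub 1
  have h2 : HasDerivAt (fun y => Complex.sqrt (1 - x * Complex.exp y))
      ((2 * Complex.sqrt u)⁻¹ * -(x * Complex.exp y)) y :=
    HasDerivAt.comp y (h₂ := Complex.sqrt) (hasDerivAt_complex_sqrt (u := u) (Or.inl h)) h1
  have h3 := (h2.const_add 1).clog (Or.inl (by simp; linarith))
  have h4 := ((hasDerivAt_id y).sub (h3.const_mul 2)).div_const (b : ℂ)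
  convert! h4 using 1
  have hx : x * Complex.exp y = 1 - Complex.sqrt u ^ 2 := by rw [sqrt_sq_eq]; ring
  rw [← hu, hx]
  have : (b : ℂ) ≠ 0 := by exact_mod_cast hb
  field_simp
  ring

/-- Parameters of the repelling fixed point `1 - σ ^ 2` of `f`. -/
structure IsFixedParam (b : ℕ) (σ : ℝ) : Prop where
  two_le : 2 ≤ b
  one_lt : 1 < b * σ
  lt_one : σ < 1
  pow_eq : (1 - σ ^ 2) ^ b = (1 - σ) / (1 + σ)

lemma exists_fixedParam {b : ℕ} (hb : 2 ≤ b) : ∃ σ, IsFixedParam b σ := by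
  obtain ⟨n, rfl⟩ : ∃ n, b = n + 1 := ⟨b - 1, by omega⟩
  have hn : 1 ≤ n := by omega
  set B : ℝ := ((n + 1 : ℕ) : ℝ) with hB
  have hB2 : 2 ≤ B := by rw [hB]; exact_mod_cast hb
  -- The equation `pow_eq` has the spurious root `σ = 1`; dividing by `1 - σ` turns it into `F σ =
  -- 1`.
  let F : ℝ → ℝ := fun σ => (1 - σ) ^ n * (1 + σ) ^ (n + 2)
  have hF : Continuous F := by fun_prop
  have hle : (1 / B) ≤ 1 := by rw [div_le_one (by linarith)]; linarith
  have h1 : F 1 = 0 := by simp [F]; omega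
  -- Bernoulli's inequality at `1 / b` places the root to the right of `1 / b`, which makes the
  -- fixed point repelling.
  have h0 : 1 < F (1 / B) := by
    have e : F (1 / B) = (1 + (-(1 / B ^ 2))) ^ n * (1 + 1 / B) ^ 2 := by
      simp only [F]
      rw [pow_add, ← mul_assoc, ← mul_pow]
      congr 2
      ring
    have hbern := one_add_mul_le_pow (a := -(1 / B ^ 2)) (by
      have : 1 / B ^ 2 ≤ 1 := by rw [div_le_one (by positivity)]; nlinarith
      linarith) n
    have hnB : (n : ℝ) = B - 1 := by rw [hB]; push_cast; ring
    rw [e]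
    refine lt_of_lt_of_le ?_ (mul_le_mul_of_nonneg_right hbern (by positivity))
    rw [hnB]
    have : (1 + (B - 1) * -(1 / B ^ 2)) * (1 + 1 / B) ^ 2 = 1 + (B ^ 3 + B + 1) / B ^ 4 := by
      field_simp
      ring
    rw [this]
    have : 0 < (B ^ 3 + B + 1) / B ^ 4 := by positivity
    linarith
  obtain ⟨σ, hσ, hσ1⟩ := intermediate_value_Ioo' hle hF.continuousOn
    (show (1 : ℝ) ∈ Ioo (F 1) (F (1 / B)) from ⟨by rw [h1]; norm_num, h0⟩)
  have hσ0 : 0 < σ := lt_trans (by positivity) hσ.1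
  refine ⟨σ, hb, ?_, hσ.2, ?_⟩
  · have := hσ.1
    rw [div_lt_iff₀ (by linarith)] at this
    linarith
  · rw [eq_div_iff (by linarith)]
    calc (1 - σ ^ 2) ^ (n + 1) * (1 + σ) = ((1 - σ) * (1 + σ)) ^ (n + 1) * (1 + σ) := by ring
      _ = F σ * (1 - σ) := by simp only [F]; rw [mul_pow]; ring
      _ = 1 - σ := by rw [hσ1, one_mul]

namespace IsFixedParam

variable {b : ℕ} {σ : ℝ}

lemma pos (hσ : IsFixedParam b σ) : 0 < σ :=
  pos_of_mul_pos_right (zero_lt_one.trans hσ.one_lt) (Nat.cast_nonneg b)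

lemma fixed_pos (hσ : IsFixedParam b σ) : 0 < 1 - σ ^ 2 := by
  nlinarith [hσ.pos, hσ.lt_one]

lemma sq_le_re (hσ : IsFixedParam b σ) {x y : ℂ} (hx : ‖x‖ ≤ 1)
    (hy : y.re ≤ Real.log (1 - σ ^ 2)) : σ ^ 2 ≤ (1 - x * Complex.exp y).re := by
  have h1 : ‖x * Complex.exp y‖ ≤ 1 - σ ^ 2 := by
    rw [norm_mul, Complex.norm_exp]
    have := (Real.le_log_iff_exp_le hσ.fixed_pos).1 hy
    calc _ ≤ 1 * Real.exp y.re := by gcongr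
      _ ≤ _ := by linarith
  have := (Complex.re_le_norm (x * Complex.exp y)).trans h1
  simp only [Complex.sub_re, Complex.one_re]
  linarith

lemma re_pos (hσ : IsFixedParam b σ) {x y : ℂ} (hx : ‖x‖ ≤ 1)
    (hy : y.re ≤ Real.log (1 - σ ^ 2)) : 0 < (1 - x * Complex.exp y).re :=
  lt_of_lt_of_le (pow_pos hσ.pos 2) (hσ.sq_le_re hx hy)

lemma b_pos (hσ : IsFixedParam b σ) : (0 : ℝ) < b := by
  have := hσ.two_le
  positivity

lemma mul_log (hσ : IsFixedParam b σ) :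
    b * Real.log (1 - σ ^ 2) = Real.log (1 - σ ^ 2) - 2 * Real.log (1 + σ) := by
  have h0 := hσ.pos
  have h1 := hσ.lt_one
  rw [← Real.log_pow, hσ.pow_eq, show 1 - σ ^ 2 = (1 - σ) * (1 + σ) by ring,
    Real.log_mul (by linarith) (by linarith), Real.log_div (by linarith) (by linarith)]
  ring

/-- The square root has real part at least `σ`, so the logarithm subtracts at least `2 * log (1 +
σ)`; by `mul_log` this is exactly what keeps the half-plane invariant. -/
lemma logBranch_re_le (hσ : IsFixedParam b σ) {x y : ℂ} (hx : ‖x‖ ≤ 1)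
    (hy : y.re ≤ Real.log (1 - σ ^ 2)) : (logBranch b x y).re ≤ Real.log (1 - σ ^ 2) := by
  have hs := le_re_sqrt (hσ.sq_le_re hx hy)
  have h0 := hσ.pos
  have e : (logBranch b x y).re
      = (y.re - 2 * Real.log ‖1 + Complex.sqrt (1 - x * Complex.exp y)‖) / b := by
    rw [logBranch, Complex.div_natCast_re, Complex.sub_re, ← Complex.log_re]
    simp
  have h2 : Real.log (1 + σ) ≤ Real.log ‖1 + Complex.sqrt (1 - x * Complex.exp y)‖ := by
    apply Real.log_le_log (by linarith)
    refine le_trans ?_ (Complex.re_le_norm _)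
    simpa using hs
  rw [e, div_le_iff₀ hσ.b_pos]
  linarith [hσ.mul_log]

/-- The derivative is `1 / (b s)` with `Re s ≥ σ`, and the half-plane is convex. -/
lemma norm_logBranch_sub_le (hσ : IsFixedParam b σ) {x y y' : ℂ} (hx : ‖x‖ ≤ 1)
    (hy : y.re ≤ Real.log (1 - σ ^ 2)) (hy' : y'.re ≤ Real.log (1 - σ ^ 2)) :
    ‖logBranch b x y - logBranch b x y'‖ ≤ (b * σ)⁻¹ * ‖y - y'‖ := by
  have hconv : Convex ℝ {y : ℂ | y.re ≤ Real.log (1 - σ ^ 2)} := convex_halfSpace_re_le _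
  have hb0 : b ≠ 0 := by have := hσ.two_le; omega
  refine hconv.norm_image_sub_le_of_norm_hasDerivWithin_le
    (fun z hz => (hasDerivAt_logBranch hb0 (hσ.re_pos hx hz)).hasDerivWithinAt) ?_ hy' hy
  intro z hz
  have h1 := le_re_sqrt (hσ.sq_le_re hx hz)
  rw [norm_div, norm_one, norm_mul, Complex.norm_natCast, one_div]
  have := h1.trans (Complex.re_le_norm _)
  have := hσ.pos
  have := hσ.b_pos
  gcongr

lemma logBranch_fixed (hσ : IsFixedParam b σ) :
    logBranch b 1 (Real.log (1 - σ ^ 2) : ℝ) = (Real.log (1 - σ ^ 2) : ℝ) := by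
  have h0 := hσ.pos
  have hs : Complex.sqrt (1 - 1 * Complex.exp (Real.log (1 - σ ^ 2) : ℝ)) = (σ : ℝ) := by
    rw [← Complex.ofReal_exp, Real.exp_log hσ.fixed_pos]
    have : (1 - 1 * ((1 - σ ^ 2 : ℝ) : ℂ)) = ((σ ^ 2 : ℝ) : ℂ) := by push_cast; ring
    rw [this, Complex.sqrt, ← Complex.ofReal_ofNat, ← Complex.ofReal_inv, ← Complex.ofReal_cpow
      (by positivity), ← one_div, ← Real.sqrt_eq_rpow, Real.sqrt_sq h0.le]
  have hb := hσ.b_pos.ne'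
  rw [logBranch, hs]
  have : Complex.log (1 + (σ : ℂ)) = (Real.log (1 + σ) : ℝ) := by
    rw [Complex.ofReal_log (by linarith)]; simp
  rw [this, div_eq_iff (by exact_mod_cast hb)]
  have : Real.log (1 - σ ^ 2) - 2 * Real.log (1 + σ) = Real.log (1 - σ ^ 2) * b := by
    linarith [hσ.mul_log]
  exact_mod_cast this

lemma differentiableAt_logBranch (hσ : IsFixedParam b σ) {w : ℂ → ℂ} {z : ℂ}
    (hw : DifferentiableAt ℂ w (z ^ b)) (hz : ‖z‖ ≤ 1)
    (hy : (w (z ^ b)).re ≤ Real.log (1 - σ ^ 2)) :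
    DifferentiableAt ℂ (fun z => logBranch b (z ^ b) (w (z ^ b))) z := by
  have hzb : ‖z ^ b‖ ≤ 1 := by rw [norm_pow]; exact pow_le_one₀ (norm_nonneg _) hz
  have h1 := hσ.re_pos hzb hy
  have h2 := le_re_sqrt (hσ.sq_le_re hzb hy)
  have h0 := hσ.pos
  have hc : DifferentiableAt ℂ (fun z => w (z ^ b)) z :=
    DifferentiableAt.comp z hw (differentiableAt_pow b)
  have hq : DifferentiableAt ℂ (fun z => Complex.sqrt (1 - z ^ b * Complex.exp (w (z ^ b)))) z :=
    DifferentiableAt.comp z (g := Complex.sqrt)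
      (Complex.differentiableAt_sqrt (Or.inl h1)) (by fun_prop)
  have hl : DifferentiableAt ℂ
      (fun z => Complex.log (1 + Complex.sqrt (1 - z ^ b * Complex.exp (w (z ^ b))))) z :=
    (hq.const_add 1).clog (Or.inl (by simp; linarith))
  unfold logBranch
  fun_prop

lemma continuousOn_logBranch (hσ : IsFixedParam b σ) {w : ℂ → ℂ}
    (hw : ContinuousOn w (Metric.closedBall 0 1))
    (hy : ∀ z ∈ Metric.closedBall (0 : ℂ) 1, (w z).re ≤ Real.log (1 - σ ^ 2)) :
    ContinuousOn (fun z => logBranch b (z ^ b) (w (z ^ b))) (Metric.closedBall 0 1) := by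
  have hm : MapsTo (fun z : ℂ => z ^ b) (Metric.closedBall 0 1) (Metric.closedBall 0 1) := by
    intro z hz
    rw [mem_closedBall_zero_iff] at hz ⊢
    rw [norm_pow]
    exact pow_le_one₀ (norm_nonneg _) hz
  have hc : ContinuousOn (fun z => w (z ^ b)) (Metric.closedBall 0 1) :=
    hw.comp (by fun_prop) hm
  have h0 := hσ.pos
  have hq : ContinuousOn (fun z => Complex.sqrt (1 - z ^ b * Complex.exp (w (z ^ b))))
      (Metric.closedBall 0 1) :=
    Complex.continuousOn_sqrt.comp (by fun_prop)
      (fun z hz => Or.inl (hσ.re_pos (mem_closedBall_zero_iff.1 (hm hz)) (hy _ (hm hz))))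
  have hl : ContinuousOn
      (fun z => Complex.log (1 + Complex.sqrt (1 - z ^ b * Complex.exp (w (z ^ b)))))
      (Metric.closedBall 0 1) := by
    refine (hq.const_add 1).clog (fun z hz => Or.inl ?_)
    have := le_re_sqrt (hσ.sq_le_re (mem_closedBall_zero_iff.1 (hm hz)) (hy _ (hm hz)))
    simp
    linarith
  unfold logBranch
  fun_prop

end IsFixedParam

/-! ### Construction of the inverse Riemann map -/

/-- Successive approximations of `log (φ z / z)`, for the inverse Böttcher coordinate `φ`. -/
noncomputable def logIter (b : ℕ) (σ : ℝ) : ℕ → ℂ → ℂ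
  | 0 => fun _ => (Real.log (1 - σ ^ 2) : ℝ)
  | n + 1 => fun z => logBranch b (z ^ b) (logIter b σ n (z ^ b))

lemma pow_mem_closedBall (b : ℕ) {z : ℂ} (hz : z ∈ Metric.closedBall (0 : ℂ) 1) :
    z ^ b ∈ Metric.closedBall (0 : ℂ) 1 := by
  rw [mem_closedBall_zero_iff] at hz ⊢
  rw [norm_pow]
  exact pow_le_one₀ (norm_nonneg _) hz

lemma pow_mem_ball {b : ℕ} (hb : b ≠ 0) {z : ℂ} (hz : z ∈ Metric.ball (0 : ℂ) 1) :
    z ^ b ∈ Metric.ball (0 : ℂ) 1 := by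
  rw [mem_ball_zero_iff] at hz ⊢
  rw [norm_pow]
  exact pow_lt_one₀ (norm_nonneg _) hz hb

namespace IsFixedParam

variable {b : ℕ} {σ : ℝ}

lemma logIter_re_le (hσ : IsFixedParam b σ) (n : ℕ) {z : ℂ} (hz : z ∈ Metric.closedBall (0 : ℂ) 1) :
    (logIter b σ n z).re ≤ Real.log (1 - σ ^ 2) := by
  induction n generalizing z with
  | zero => simp [logIter]
  | succ n ih =>
    have := pow_mem_closedBall b hz
    exact hσ.logBranch_re_le (mem_closedBall_zero_iff.1 this) (ih this)

lemma continuousOn_logIter (hσ : IsFixedParam b σ) (n : ℕ) :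
    ContinuousOn (logIter b σ n) (Metric.closedBall 0 1) := by
  induction n with
  | zero => exact continuousOn_const
  | succ n ih => exact hσ.continuousOn_logBranch ih (fun z hz => hσ.logIter_re_le n hz)

lemma differentiableOn_logIter (hσ : IsFixedParam b σ) (n : ℕ) :
    DifferentiableOn ℂ (logIter b σ n) (Metric.ball 0 1) := by
  induction n with
  | zero => exact differentiableOn_const _
  | succ n ih =>
    intro z hz
    have hb : b ≠ 0 := by have := hσ.two_le; omega
    have hzb := pow_mem_ball hb hz
    exact (hσ.differentiableAt_logBranch (ih.differentiableAt (Metric.isOpen_ball.mem_nhds hzb))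
      (mem_ball_zero_iff.1 hz).le
      (hσ.logIter_re_le n (Metric.ball_subset_closedBall hzb))).differentiableWithinAt

lemma exists_dist_logIter_le (hσ : IsFixedParam b σ) :
    ∃ C : ℝ, ∀ n, ∀ z ∈ Metric.closedBall (0 : ℂ) 1,
      dist (logIter b σ n z) (logIter b σ (n + 1) z) ≤ C * ((b * σ)⁻¹) ^ n := by
  obtain ⟨C, hC⟩ := (isCompact_closedBall (0 : ℂ) 1).exists_bound_of_continuousOn
    ((hσ.continuousOn_logIter 0).sub (hσ.continuousOn_logIter 1))
  refine ⟨C, fun n => ?_⟩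
  induction n with
  | zero => intro z hz; simpa [dist_eq_norm] using hC z hz
  | succ n ih =>
    intro z hz
    have hzb := pow_mem_closedBall b hz
    rw [dist_eq_norm]
    refine (hσ.norm_logBranch_sub_le (mem_closedBall_zero_iff.1 hzb)
      (hσ.logIter_re_le n hzb) (hσ.logIter_re_le (n + 1) hzb)).trans ?_
    have h1 := ih _ hzb
    rw [dist_eq_norm] at h1
    have : (0 : ℝ) ≤ (b * σ)⁻¹ := by have := hσ.one_lt; positivity
    calc _ ≤ (b * σ)⁻¹ * (C * ((b * σ)⁻¹) ^ n) := by gcongr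
      _ = _ := by ring

end IsFixedParam

lemma exists_log_fixedPoint {b : ℕ} {σ : ℝ} (hσ : IsFixedParam b σ) :
    ∃ v : ℂ → ℂ, ContinuousOn v (Metric.closedBall 0 1) ∧
      DifferentiableOn ℂ v (Metric.ball 0 1) ∧
      (∀ z ∈ Metric.closedBall (0 : ℂ) 1, (v z).re ≤ Real.log (1 - σ ^ 2)) ∧
      (∀ z ∈ Metric.closedBall (0 : ℂ) 1, v z = logBranch b (z ^ b) (v (z ^ b))) ∧
      v 1 = (Real.log (1 - σ ^ 2) : ℝ) := by
  obtain ⟨C, hC⟩ := hσ.exists_dist_logIter_le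
  have hq1 : (b * σ)⁻¹ < 1 := inv_lt_one_of_one_lt₀ hσ.one_lt
  have hq0 : (0 : ℝ) ≤ (b * σ)⁻¹ := by have := hσ.one_lt; positivity
  have hlim : ∀ z, ∃ w, z ∈ Metric.closedBall (0 : ℂ) 1 →
      Tendsto (fun n => logIter b σ n z) atTop (𝓝 w) := by
    intro z
    by_cases hz : z ∈ Metric.closedBall (0 : ℂ) 1
    · obtain ⟨w, hw⟩ := cauchySeq_tendsto_of_complete
        (cauchySeq_of_le_geometric _ C hq1 (fun n => hC n z hz))
      exact ⟨w, fun _ => hw⟩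
    · exact ⟨0, fun h => absurd h hz⟩
  choose v hv using hlim
  have hunif : TendstoUniformlyOn (logIter b σ) v atTop (Metric.closedBall 0 1) := by
    rw [Metric.tendstoUniformlyOn_iff]
    intro ε hε
    have ht : Tendsto (fun n : ℕ => C * ((b * σ)⁻¹) ^ n / (1 - (b * σ)⁻¹)) atTop (𝓝 0) := by
      simpa using ((tendsto_pow_atTop_nhds_zero_of_lt_one hq0 hq1).const_mul C).div_const
        (1 - (b * σ)⁻¹)
    filter_upwards [ht.eventually (gt_mem_nhds hε)] with n hn z hz
    rw [dist_comm]
    exact (dist_le_of_le_geometric_of_tendsto _ C hq1 (fun n => hC n z hz) (hv z hz) n).trans_lt hn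
  have hre : ∀ z ∈ Metric.closedBall (0 : ℂ) 1, (v z).re ≤ Real.log (1 - σ ^ 2) := fun z hz =>
    le_of_tendsto ((Complex.continuous_re.tendsto _).comp (hv z hz))
      (Eventually.of_forall fun n => hσ.logIter_re_le n hz)
  have hfix : ∀ z ∈ Metric.closedBall (0 : ℂ) 1, v z = logBranch b (z ^ b) (v (z ^ b)) := by
    intro z hz
    have hzb := pow_mem_closedBall b hz
    have hb : b ≠ 0 := by have := hσ.two_le; omega
    have hc := (hasDerivAt_logBranch hb (hσ.re_pos (mem_closedBall_zero_iff.1 hzb)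
      (hre _ hzb))).continuousAt
    exact tendsto_nhds_unique ((hv z hz).comp (tendsto_add_atTop_nat 1))
      (hc.tendsto.comp (hv _ hzb))
  refine ⟨v, hunif.continuousOn (Frequently.of_forall hσ.continuousOn_logIter), ?_, hre, hfix, ?_⟩
  · exact (hunif.mono Metric.ball_subset_closedBall).tendstoLocallyUniformlyOn.differentiableOn
      (Eventually.of_forall hσ.differentiableOn_logIter) Metric.isOpen_ball
  · have h1 : (1 : ℂ) ∈ Metric.closedBall (0 : ℂ) 1 := by simp
    have h2 := hσ.norm_logBranch_sub_le (x := 1) (by simp) (hre 1 h1)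
      (y' := (Real.log (1 - σ ^ 2) : ℝ)) (by simp)
    have h3 := hfix 1 h1
    rw [one_pow] at h3
    rw [← h3, hσ.logBranch_fixed] at h2
    -- Both `v 1` and the logarithm of the fixed point are fixed by the same strict contraction.
    by_contra hne
    have : 0 < ‖v 1 - (Real.log (1 - σ ^ 2) : ℝ)‖ := norm_pos_iff.2 (sub_ne_zero.2 hne)
    nlinarith

/-- With `s = (1 - w) / (1 + w)`, the equation `4 w / (1 + w)^2 = u` reads `s^2 = 1 - u`, so `w = (1
- s) / (1 + s) = u / (1 + s)^2`. For `w = (z * exp (v z))^b` this is the exponential of the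
fixed-point equation for `v`. -/
lemma map_eq_of_logBranch {b : ℕ} {σ : ℝ} (hσ : IsFixedParam b σ) {v : ℂ → ℂ}
    (hre : ∀ z ∈ Metric.closedBall (0 : ℂ) 1, (v z).re ≤ Real.log (1 - σ ^ 2))
    (hfix : ∀ z ∈ Metric.closedBall (0 : ℂ) 1, v z = logBranch b (z ^ b) (v (z ^ b)))
    {z : ℂ} (hz : z ∈ Metric.closedBall (0 : ℂ) 1) :
    z ^ b * Complex.exp (v (z ^ b)) = f b (z * Complex.exp (v z)) := by
  have hzb := pow_mem_closedBall b hz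
  have hb0 : (b : ℂ) ≠ 0 := by exact_mod_cast hσ.b_pos.ne'
  set u := z ^ b * Complex.exp (v (z ^ b)) with hu
  set s := Complex.sqrt (1 - u) with hs
  have hs2 : s ^ 2 = 1 - u := sqrt_sq_eq _
  have hsre : 0 < s.re :=
    hσ.pos.trans_le (le_re_sqrt (hσ.sq_le_re (mem_closedBall_zero_iff.1 hzb) (hre _ hzb)))
  have hs1 : 1 + s ≠ 0 := fun h => by
    have := congrArg Complex.re h
    simp at this
    linarith
  have hw : (z * Complex.exp (v z)) ^ b = (1 - s) / (1 + s) := by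
    rw [mul_pow, ← Complex.exp_nat_mul, hfix z hz, logBranch, ← hu, ← hs, mul_div_cancel₀ _ hb0,
      Complex.exp_sub, show (2 : ℂ) * Complex.log (1 + s) = ((2 : ℕ) : ℂ) * Complex.log (1 + s) by
        norm_num, Complex.exp_nat_mul, Complex.exp_log hs1, ← mul_div_assoc, ← hu,
      show u = 1 - s ^ 2 by rw [hs2]; ring]
    field_simp
    ring
  rw [f, hw, show u = 1 - s ^ 2 by rw [hs2]; ring]
  have h2 : 1 + (1 - s) / (1 + s) = 2 / (1 + s) := by field_simp; ring
  rw [h2]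
  field_simp
  ring

lemma iterate_map_eq {b : ℕ} {φ : ℂ → ℂ}
    (hφ : ∀ z ∈ Metric.closedBall (0 : ℂ) 1, φ (z ^ b) = f b (φ z)) (n : ℕ) {z : ℂ}
    (hz : z ∈ Metric.closedBall (0 : ℂ) 1) : (f b)^[n] (φ z) = φ (z ^ b ^ n) := by
  induction n with
  | zero => simp
  | succ n ih =>
    rw [Function.iterate_succ_apply', ih, ← hφ _ (pow_mem_closedBall _ hz), ← pow_mul, pow_succ]

lemma tendsto_pow_pow_zero {b : ℕ} (hb : 2 ≤ b) {z : ℂ} (hz : z ∈ Metric.ball (0 : ℂ) 1) :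
    Tendsto (fun n : ℕ => z ^ b ^ n) atTop (𝓝 0) :=
  (tendsto_pow_atTop_nhds_zero_of_norm_lt_one (mem_ball_zero_iff.1 hz)).comp
    (tendsto_pow_atTop_atTop_of_one_lt (by omega))

/-- On the unit circle, the orbit of `φ z` does not tend to `0`. -/
lemma not_mem_basin_of_sphere {b : ℕ} {φ : ℂ → ℂ}
    (hcont : ContinuousOn φ (Metric.closedBall 0 1))
    (hφ : ∀ z ∈ Metric.closedBall (0 : ℂ) 1, φ (z ^ b) = f b (φ z))
    (hne : ∀ z ∈ Metric.sphere (0 : ℂ) 1, φ z ≠ 0) {z : ℂ} (hz : z ∈ Metric.sphere (0 : ℂ) 1) :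
    φ z ∉ basin b := by
  intro hmem
  have hzc := Metric.sphere_subset_closedBall hz
  -- The circle is invariant under `z ↦ z^b`, so the minimum of `‖φ‖` on it bounds the whole orbit
  -- away from `0`.
  obtain ⟨w, hw, hmin⟩ := (isCompact_sphere (0 : ℂ) 1).exists_isMinOn ⟨z, hz⟩
    (hcont.mono Metric.sphere_subset_closedBall).norm
  have h0 : 0 < ‖φ w‖ := norm_pos_iff.2 (hne w hw)
  have h1 : Tendsto (fun n : ℕ => ‖(f b)^[n] (φ z)‖) atTop (𝓝 0) := by
    simpa using (show Tendsto (fun n : ℕ => (f b)^[n] (φ z)) atTop (𝓝 0) from hmem).norm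
  obtain ⟨n, hn⟩ := (h1.eventually (gt_mem_nhds h0)).exists
  rw [iterate_map_eq hφ n hzc] at hn
  have : z ^ b ^ n ∈ Metric.sphere (0 : ℂ) 1 := by
    rw [mem_sphere_zero_iff_norm] at hz ⊢
    rw [norm_pow, hz, one_pow]
  exact absurd hn (not_lt.2 (hmin this))

lemma zero_mem_basin {b : ℕ} (hb : 2 ≤ b) : (0 : ℂ) ∈ basin b := by
  have h : ∀ n, (f b)^[n] 0 = 0 := fun n =>
    Function.iterate_fixed (by simp [f, show b ≠ 0 by omega]) n
  simp [basin, h]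

lemma exists_isInverseRiemannMap {b : ℕ} (hb : 2 ≤ b) : ∃ φ, IsInverseRiemannMap b φ := by
  obtain ⟨σ, hσ⟩ := exists_fixedParam hb
  obtain ⟨v, hvc, hvd, hre, hfix, hv1⟩ := exists_log_fixedPoint hσ
  set φ : ℂ → ℂ := fun z => z * Complex.exp (v z) with hφ
  have hb0 : b ≠ 0 := by omega
  have hmap : ∀ z ∈ Metric.closedBall (0 : ℂ) 1, φ (z ^ b) = f b (φ z) :=
    fun z hz => map_eq_of_logBranch hσ hre hfix hz
  have hcont : ContinuousOn φ (Metric.closedBall 0 1) :=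
    continuousOn_id.mul (Complex.continuous_exp.comp_continuousOn hvc)
  have hdiff : DifferentiableOn ℂ φ (Metric.ball 0 1) := differentiableOn_id.mul hvd.cexp
  have hφ0 : φ 0 = 0 := by simp [hφ]
  have hne : ∀ z ∈ Metric.sphere (0 : ℂ) 1, φ z ≠ 0 := fun z hz =>
    mul_ne_zero (ne_zero_of_mem_unit_sphere ⟨z, hz⟩) (Complex.exp_ne_zero _)
  have h0mem : (0 : ℂ) ∈ Metric.ball (0 : ℂ) 1 := by simp
  have hnhds : Metric.ball (0 : ℂ) 1 ∈ 𝓝 (0 : ℂ) := Metric.isOpen_ball.mem_nhds h0mem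
  have hbasin : φ '' Metric.ball 0 1 ⊆ basin b := by
    rintro _ ⟨z, hz, rfl⟩
    have h1 := (hcont.continuousAt (mem_of_superset hnhds Metric.ball_subset_closedBall)).tendsto
    have h2 := h1.comp (tendsto_pow_pow_zero hb hz)
    rw [hφ0] at h2
    refine h2.congr fun n => ?_
    rw [iterate_map_eq hmap n (Metric.ball_subset_closedBall hz)]
    rfl
  have hinj : InjOn φ (Metric.ball 0 1) := by
    have hderiv : HasDerivAt φ (Complex.exp (v 0)) 0 := by
      have h1 := (hasDerivAt_id (0 : ℂ)).mul
        (hvd.differentiableAt hnhds).hasDerivAt.cexp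
      convert! h1 using 1
      simp
    have hstrict : HasStrictDerivAt φ (Complex.exp (v 0)) 0 := by
      have h1 : AnalyticAt ℂ φ 0 := hdiff.analyticAt hnhds
      have := h1.hasStrictDerivAt
      rwa [hderiv.deriv] at this
    -- Strict differentiability with nonzero derivative gives injectivity near `0`; the dynamics
    -- pulls every pair of points into that neighbourhood.
    have hloc : ∀ᶠ p : ℂ × ℂ in 𝓝 (0, 0), φ p.1 = φ p.2 → p.1 = p.2 := by
      have h1 := (hstrict.isLittleO).def
        (show (0 : ℝ) < ‖Complex.exp (v 0)‖ / 2 by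
          have := norm_pos_iff.2 (Complex.exp_ne_zero (v 0)); positivity)
      filter_upwards [h1] with p hp heq
      by_contra hpne
      have h2 : 0 < ‖p.1 - p.2‖ := norm_pos_iff.2 (sub_ne_zero.2 hpne)
      have h3 := norm_pos_iff.2 (Complex.exp_ne_zero (v 0))
      rw [heq] at hp
      simp at hp
      nlinarith
    intro z₁ h₁ z₂ h₂ heq
    have hev := ((tendsto_pow_pow_zero hb h₁).prodMk_nhds (tendsto_pow_pow_zero hb h₂)).eventually
      hloc
    obtain ⟨n, hn⟩ := hev.exists
    have hn' : z₁ ^ b ^ n = z₂ ^ b ^ n := by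
      apply hn
      rw [← iterate_map_eq hmap n (Metric.ball_subset_closedBall h₁),
        ← iterate_map_eq hmap n (Metric.ball_subset_closedBall h₂), heq]
    -- Descent from equal powers to equal points: `v z` depends only on `z^b`, so once the `b`-th
    -- powers agree the exponential factors cancel.
    have key : ∀ n : ℕ, ∀ z₁ ∈ Metric.ball (0 : ℂ) 1, ∀ z₂ ∈ Metric.ball (0 : ℂ) 1,
        φ z₁ = φ z₂ → z₁ ^ b ^ n = z₂ ^ b ^ n → z₁ = z₂ := by
      intro n
      induction n with
      | zero => intro z₁ _ z₂ _ _ h; simpa using h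
      | succ n ih =>
        intro z₁ h₁ z₂ h₂ he h
        have hpow : z₁ ^ b = z₂ ^ b := by
          apply ih _ (pow_mem_ball hb0 h₁) _ (pow_mem_ball hb0 h₂)
          · rw [hmap _ (Metric.ball_subset_closedBall h₁),
              hmap _ (Metric.ball_subset_closedBall h₂), he]
          · rw [← pow_mul, ← pow_mul, ← pow_succ', h]
        have hv : v z₁ = v z₂ := by
          rw [hfix _ (Metric.ball_subset_closedBall h₁),
            hfix _ (Metric.ball_subset_closedBall h₂), hpow]
        simp only [hφ, hv] at he
        exact mul_right_cancel₀ (Complex.exp_ne_zero _) he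
    exact key n z₁ h₁ z₂ h₂ heq hn'
  have hopen : IsOpen (φ '' Metric.ball 0 1) := by
    have hA : AnalyticOnNhd ℂ φ (Metric.ball 0 1) := hdiff.analyticOnNhd Metric.isOpen_ball
    rcases hA.is_constant_or_isOpen (convex_ball _ _).isPreconnected with ⟨w, hw⟩ | h
    · exfalso
      have h2 : (1 / 2 : ℂ) ∈ Metric.ball (0 : ℂ) 1 := by
        rw [mem_ball_zero_iff]; norm_num
      have := hinj h0mem h2 ((hw _ h0mem).trans (hw _ h2).symm)
      norm_num at this
    · exact h _ subset_rfl Metric.isOpen_ball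
  have himage : φ '' Metric.ball 0 1 = Omega0 b := by
    apply Subset.antisymm
    · exact ((convex_ball _ _).isPreconnected.image _ hdiff.continuousOn).subset_connectedComponentIn
        ⟨0, h0mem, hφ0⟩ hbasin
    · have hclosed : IsClosed (φ '' Metric.closedBall 0 1) :=
        ((isCompact_closedBall _ _).image_of_continuousOn hcont).isClosed
      -- The image of the circle avoids the basin, so the connected set `Omega0 b` is covered by two
      -- disjoint open sets, and it meets the first at `0`.
      have hcover : Omega0 b ⊆ φ '' Metric.ball 0 1 ∪ (φ '' Metric.closedBall 0 1)ᶜ := by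
        intro t ht
        by_cases h : t ∈ φ '' Metric.closedBall 0 1
        · obtain ⟨z, hz, rfl⟩ := h
          rcases (mem_closedBall_zero_iff.1 hz).lt_or_eq with h | h
          · exact Or.inl ⟨z, mem_ball_zero_iff.2 h, rfl⟩
          · exact absurd (connectedComponentIn_subset _ _ ht)
              (not_mem_basin_of_sphere hcont hmap hne (mem_sphere_zero_iff_norm.2 h))
        · exact Or.inr h
      refine isPreconnected_connectedComponentIn.subset_left_of_subset_union hopen
        hclosed.isOpen_compl ?_ hcover ?_
      · exact disjoint_compl_right.mono_left (image_mono Metric.ball_subset_closedBall)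
      · exact ⟨0, mem_connectedComponentIn (zero_mem_basin hb), ⟨0, h0mem, hφ0⟩⟩
  refine ⟨φ, hdiff, hcont, ?_, hφ0, hmap, 1 - σ ^ 2, ⟨hσ.fixed_pos, ?_⟩, ?_⟩
  · rw [← himage]; exact hinj.bijOn_image
  · have := pow_pos hσ.pos 2; linarith
  · simp only [hφ, hv1]
    rw [← Complex.ofReal_exp, Real.exp_log hσ.fixed_pos, one_mul]

lemma isInverseRiemannMap_psiInv {b : ℕ} (hb : 2 ≤ b) : IsInverseRiemannMap b (psiInv b) :=
  Classical.epsilon_spec (exists_isInverseRiemannMap hb)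

/-! ### Boundary behaviour of the inverse Riemann map -/

namespace IsInverseRiemannMap

variable {b : ℕ} {φ : ℂ → ℂ}

lemma mapsTo_closure (hφ : IsInverseRiemannMap b φ) :
    MapsTo φ (Metric.closedBall 0 1) (closure (Omega0 b)) := by
  have h := hφ.bijOn.mapsTo
  rw [← closure_ball (0 : ℂ) one_ne_zero]
  refine h.closure_of_continuousOn ?_
  rw [closure_ball (0 : ℂ) one_ne_zero]
  exact hφ.continuousOn

/-- Otherwise the image of a smaller disk would be a neighbourhood of `φ z`, and points of the disk
close to `z` would have a second preimage in that smaller disk, against injectivity. -/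
lemma notMem_of_sphere (hφ : IsInverseRiemannMap b φ) {z : ℂ}
    (hz : z ∈ Metric.sphere (0 : ℂ) 1) : φ z ∉ Omega0 b := by
  intro hmem
  obtain ⟨w, hw, hwz⟩ := hφ.bijOn.surjOn hmem
  have hw1 := mem_ball_zero_iff.1 hw
  obtain ⟨ρ, hwρ, hρ⟩ := exists_between hw1
  have hsub : Metric.ball (0 : ℂ) ρ ⊆ Metric.ball 0 1 := Metric.ball_subset_ball hρ.le
  have hopen : IsOpen (φ '' Metric.ball 0 ρ) := by
    have hA : AnalyticOnNhd ℂ φ (Metric.ball 0 1) :=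
      hφ.differentiableOn.analyticOnNhd Metric.isOpen_ball
    rcases hA.is_constant_or_isOpen (convex_ball _ _).isPreconnected with ⟨c, hc⟩ | h
    · exfalso
      have h0 : (0 : ℂ) ∈ Metric.ball (0 : ℂ) 1 := by simp
      have h2 : (1 / 2 : ℂ) ∈ Metric.ball (0 : ℂ) 1 := by
        rw [mem_ball_zero_iff]; norm_num
      have := hφ.bijOn.injOn h0 h2 ((hc _ h0).trans (hc _ h2).symm)
      norm_num at this
    · exact h _ hsub Metric.isOpen_ball
  have hzcl : z ∈ closure (Metric.ball (0 : ℂ) 1) := by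
    rw [closure_ball (0 : ℂ) one_ne_zero]; exact Metric.sphere_subset_closedBall hz
  have hnebot : (𝓝[Metric.ball (0 : ℂ) 1] z).NeBot := mem_closure_iff_nhdsWithin_neBot.1 hzcl
  have ht : Tendsto φ (𝓝[Metric.ball (0 : ℂ) 1] z) (𝓝 (φ z)) :=
    (hφ.continuousOn z (Metric.sphere_subset_closedBall hz)).mono Metric.ball_subset_closedBall
  have h1 : ∀ᶠ y in 𝓝[Metric.ball (0 : ℂ) 1] z, φ y ∈ φ '' Metric.ball 0 ρ :=
    ht.eventually (hopen.mem_nhds ⟨w, mem_ball_zero_iff.2 hwρ, hwz⟩)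
  have h2 : ∀ᶠ y in 𝓝[Metric.ball (0 : ℂ) 1] z, ρ < ‖y‖ := by
    refine (continuous_norm.tendsto z).mono_left nhdsWithin_le_nhds |>.eventually ?_
    rw [mem_sphere_zero_iff_norm.1 hz]
    exact lt_mem_nhds hρ
  obtain ⟨y, ⟨⟨u, hu, huy⟩, hy⟩, hyb⟩ := ((h1.and h2).and self_mem_nhdsWithin).exists
  rw [hφ.bijOn.injOn (hsub hu) hyb huy] at hu
  exact lt_asymm hy (mem_ball_zero_iff.1 hu)

lemma mapsTo_frontier (hφ : IsInverseRiemannMap b φ) :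
    MapsTo φ (Metric.sphere 0 1) (frontier (Omega0 b)) := fun _ hz =>
  ⟨hφ.mapsTo_closure (Metric.sphere_subset_closedBall hz),
    fun h => hφ.notMem_of_sphere hz (interior_subset h)⟩

lemma continuousOn_comp (hφ : IsInverseRiemannMap b φ) {β : ℂ → ℂ}
    (hβ : DiffContOnCl ℂ β (Omega0 b)) : ContinuousOn (β ∘ φ) (Metric.closedBall 0 1) :=
  hβ.continuousOn.comp hφ.continuousOn hφ.mapsTo_closure

lemma differentiableOn_comp (hφ : IsInverseRiemannMap b φ) {β : ℂ → ℂ}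
    (hβ : DiffContOnCl ℂ β (Omega0 b)) : DifferentiableOn ℂ (β ∘ φ) (Metric.ball 0 1) :=
  hβ.differentiableOn.comp hφ.differentiableOn hφ.bijOn.mapsTo

end IsInverseRiemannMap

/-! ### Angles and coded inverse orbits -/

/-- The point `exp (2πiθ)` of the unit circle. -/
noncomputable def circlePoint (θ : ℝ) : ℂ := Complex.exp (2 * Real.pi * θ * Complex.I)

lemma norm_circlePoint (θ : ℝ) : ‖circlePoint θ‖ = 1 := by
  have : (2 * Real.pi * θ * Complex.I : ℂ) = ((2 * Real.pi * θ : ℝ) : ℂ) * Complex.I := by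
    push_cast; ring
  rw [circlePoint, this, Complex.norm_exp_ofReal_mul_I]

lemma continuous_circlePoint : Continuous circlePoint := by
  unfold circlePoint
  fun_prop

lemma circlePoint_mem_sphere (θ : ℝ) : circlePoint θ ∈ Metric.sphere (0 : ℂ) 1 :=
  mem_sphere_zero_iff_norm.2 (norm_circlePoint θ)

lemma circlePoint_mem_closedBall (θ : ℝ) : circlePoint θ ∈ Metric.closedBall (0 : ℂ) 1 :=
  Metric.sphere_subset_closedBall (circlePoint_mem_sphere θ)

lemma lyapunov_eq {b : ℕ} (hb : 2 ≤ b) {β : ℂ → ℂ} (hχ : lyapunov b β ≠ 0) :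
    lyapunov b β = ∫ θ in (0 : ℝ)..1, Real.log ‖β (psiInv b (circlePoint θ))‖ := by
  -- A Bochner integral without integrability is `0`, so a nonzero exponent supplies the
  -- integrability, and with it the measurability needed for the change of variables.
  have hi : Integrable (fun t => Real.log ‖β t‖) (harmonicMeasure b) := by
    by_contra h
    exact hχ (integral_undef h)
  have hc : Continuous (fun θ : ℝ => psiInv b (circlePoint θ)) :=
    (isInverseRiemannMap_psiInv hb).continuousOn.comp_continuous continuous_circlePoint
      circlePoint_mem_closedBall
  have := integral_map (μ := volume.restrict (Ico (0 : ℝ) 1)) hc.aemeasurable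
    hi.aestronglyMeasurable
  rw [intervalIntegral.integral_of_le zero_le_one, ← integral_Ico_eq_integral_Ioc]
  exact this

lemma diskPoint_eq (b : ℕ) (r : ℝ) (ε : BiSeq b) (k : ℕ) :
    diskPoint b r ε k = ((r ^ (((b : ℝ) ^ k)⁻¹) : ℝ) : ℂ) *
      circlePoint (Real.ofDigits (fun j : ℕ => ε ((j : ℤ) - k))) := rfl

lemma norm_diskPoint (b : ℕ) {r : ℝ} (hr : 0 ≤ r) (ε : BiSeq b) (k : ℕ) :
    ‖diskPoint b r ε k‖ = r ^ (((b : ℝ) ^ k)⁻¹) := by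
  rw [diskPoint_eq, norm_mul, norm_circlePoint, mul_one, Complex.norm_real, Real.norm_eq_abs,
    abs_of_nonneg (Real.rpow_nonneg hr _)]

lemma diskPoint_mem_closedBall (b : ℕ) {r : ℝ} (hr : r ∈ Ioc (0 : ℝ) 1) (ε : BiSeq b) (k : ℕ) :
    diskPoint b r ε k ∈ Metric.closedBall (0 : ℂ) 1 := by
  rw [mem_closedBall_zero_iff, norm_diskPoint b hr.1.le]
  exact Real.rpow_le_one hr.1.le hr.2 (by positivity)

/-- The angle `θ` (in turns) of the `k`-th point of the coded inverse orbit. -/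
noncomputable def angle {b : ℕ} (k : ℕ) (ε : BiSeq b) : ℝ :=
  Real.ofDigits (fun j : ℕ => ε ((j : ℤ) - k))

lemma angle_mem_Icc {b : ℕ} (k : ℕ) (ε : BiSeq b) : angle k ε ∈ Icc (0 : ℝ) 1 :=
  ⟨Real.ofDigits_nonneg _, Real.ofDigits_le_one _⟩

/-- One step backwards prepends the digit `ε (-(k + 1))`: this is an inverse branch of `x ↦ b x mod
1`. -/
lemma angle_succ {b : ℕ} (k : ℕ) (ε : BiSeq b) :
    angle (k + 1) ε = ((ε (-(k + 1 : ℤ)) : ℕ) + angle k ε) / b := by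
  rw [angle, Real.ofDigits_eq_sum_add_ofDigits _ 1, angle]
  have : (fun j : ℕ => ε (((j + 1 : ℕ) : ℤ) - (k + 1 : ℕ))) = fun j : ℕ => ε ((j : ℤ) - k) := by
    funext j; congr 1; push_cast; ring
  rw [this]
  simp [Real.ofDigitsTerm]
  ring

lemma continuous_angle {b : ℕ} (k : ℕ) : Continuous (angle (b := b) k) :=
  Real.continuous_ofDigits.comp (by fun_prop)

lemma diskPoint_succ_pow {b : ℕ} (hb : b ≠ 0) {r : ℝ} (hr : 0 < r) (ε : BiSeq b) (k : ℕ) :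
    diskPoint b r ε (k + 1) ^ b = diskPoint b r ε k := by
  have hb' : (b : ℝ) ≠ 0 := by exact_mod_cast hb
  have hbC : (b : ℂ) ≠ 0 := by exact_mod_cast hb
  rw [diskPoint_eq, diskPoint_eq, mul_pow, ← Complex.ofReal_pow, ← Real.rpow_natCast,
    ← Real.rpow_mul hr.le]
  congr 2
  · congr 1
    rw [pow_succ]
    field_simp
  · change circlePoint (angle (k + 1) ε) ^ b = circlePoint (angle k ε)
    rw [angle_succ, circlePoint, circlePoint, ← Complex.exp_nat_mul, Complex.exp_eq_exp_iff_exists_int]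
    refine ⟨(ε (-(k + 1 : ℤ)) : ℕ), ?_⟩
    push_cast
    field_simp
    ring

lemma solenoidPoint_mem_naturalExtension {b : ℕ} (hb : 2 ≤ b) {r : ℝ} (hr : r ∈ Ioc (0 : ℝ) 1)
    (ε : BiSeq b) : solenoidPoint b r ε ∈ naturalExtension b := by
  have hφ := isInverseRiemannMap_psiInv hb
  intro k
  refine ⟨hφ.mapsTo_closure (diskPoint_mem_closedBall b hr ε k), ?_⟩
  rw [solenoidPoint, solenoidPoint, ← hφ.map_pow _ (diskPoint_mem_closedBall b hr ε _),
    diskPoint_succ_pow (by omega) hr.1]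

/-! ### Averages over inverse branches -/

section Averaging

/-- The transfer operator of `x ↦ b x mod 1` with constant weights. -/
noncomputable def branchAverage (b : ℕ) (g : ℝ → ℝ) (x : ℝ) : ℝ :=
  (∑ i : Fin b, g (((i : ℕ) + x) / b)) / b

variable {b : ℕ}

lemma continuous_branchAverage {g : ℝ → ℝ} (hg : Continuous g) :
    Continuous (branchAverage b g) := by
  unfold branchAverage
  fun_prop

lemma continuous_iterate_branchAverage {g : ℝ → ℝ} (hg : Continuous g) (n : ℕ) :
    Continuous ((branchAverage b)^[n] g) := by
  induction n with
  | zero => exact hg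
  | succ n ih => rw [Function.iterate_succ_apply']; exact continuous_branchAverage ih

lemma inverse_branch_mem_Icc (i : Fin b) {x : ℝ} (hx : x ∈ Icc (0 : ℝ) 1) :
    ((i : ℕ) + x) / b ∈ Icc (0 : ℝ) 1 := by
  have h1 : ((i : ℕ) : ℝ) + 1 ≤ b := by exact_mod_cast i.2
  have h0 : (0 : ℝ) ≤ (i : ℕ) := by positivity
  constructor
  · exact div_nonneg (by linarith [hx.1]) (by linarith)
  · rw [div_le_one (by linarith)]; linarith [hx.2]

lemma integral_branchAverage [NeZero b] {g : ℝ → ℝ} (hg : Continuous g) :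
    ∫ x in (0 : ℝ)..1, branchAverage b g x = ∫ x in (0 : ℝ)..1, g x := by
  have hb : (b : ℝ) ≠ 0 := by exact_mod_cast NeZero.ne b
  have h1 : ∀ i : ℕ, (∫ x in (0 : ℝ)..1, g ((i + x) / b)) / b =
      ∫ x in ((i : ℝ) / b)..((i + 1 : ℕ) : ℝ) / b, g x := by
    intro i
    have := intervalIntegral.integral_comp_div_add (a := 0) (b := 1) g hb ((i : ℝ) / b)
    rw [smul_eq_mul] at this
    have e : ∀ x : ℝ, (i + x) / b = x / b + i / b := fun x => by ring
    simp_rw [e, this]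
    rw [mul_div_cancel_left₀ _ hb]
    congr 1
    · ring
    · push_cast; ring
  have h2 : ∫ x in (0 : ℝ)..1, branchAverage b g x =
      ∑ i ∈ Finset.range b, ∫ x in ((i : ℝ) / b)..((i + 1 : ℕ) : ℝ) / b, g x := by
    unfold branchAverage
    rw [intervalIntegral.integral_div, intervalIntegral.integral_finsetSum, Finset.sum_div,
      Finset.sum_range]
    · exact Finset.sum_congr rfl fun i _ => h1 i
    · intro i _
      exact Continuous.intervalIntegrable (by fun_prop) _ _
  rw [h2, intervalIntegral.sum_integral_adjacent_intervals
    (a := fun i : ℕ => (i : ℝ) / b) (fun k _ => hg.intervalIntegrable _ _)]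
  simp [hb]

lemma integral_iterate_branchAverage [NeZero b] {g : ℝ → ℝ} (hg : Continuous g) (n : ℕ) :
    ∫ x in (0 : ℝ)..1, (branchAverage b)^[n] g x = ∫ x in (0 : ℝ)..1, g x := by
  induction n with
  | zero => rfl
  | succ n ih =>
    rw [Function.iterate_succ_apply',
      integral_branchAverage (continuous_iterate_branchAverage hg n), ih]

/-- Inverse branches shrink distances by `b`, so each averaging step enlarges by `b` the scale on
which the oscillation is at most `η`. -/
lemma abs_iterate_branchAverage_sub_le [NeZero b] {g : ℝ → ℝ} {δ η : ℝ}
    (hg : ∀ x ∈ Icc (0 : ℝ) 1, ∀ y ∈ Icc (0 : ℝ) 1, |x - y| < δ → |g x - g y| ≤ η) (n : ℕ) :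
    ∀ x ∈ Icc (0 : ℝ) 1, ∀ y ∈ Icc (0 : ℝ) 1, |x - y| < b ^ n * δ →
      |(branchAverage b)^[n] g x - (branchAverage b)^[n] g y| ≤ η := by
  have hb : (0 : ℝ) < b := by exact_mod_cast Nat.pos_of_ne_zero (NeZero.ne b)
  induction n with
  | zero => simpa using hg
  | succ n ih =>
    intro x hx y hy hxy
    rw [Function.iterate_succ_apply', branchAverage, branchAverage, ← sub_div,
      ← Finset.sum_sub_distrib, abs_div, abs_of_pos hb, div_le_iff₀ hb]
    refine (Finset.abs_sum_le_sum_abs _ _).trans ?_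
    refine (Finset.sum_le_card_nsmul _ _ η ?_).trans_eq (by simp [mul_comm])
    intro i _
    refine ih _ (inverse_branch_mem_Icc i hx) _ (inverse_branch_mem_Icc i hy) ?_
    rw [show ((i : ℕ) + x) / b - ((i : ℕ) + y) / b = (x - y) / b by ring, abs_div, abs_of_pos hb,
      div_lt_iff₀ hb]
    calc |x - y| < _ := hxy
      _ = _ := by ring

/-- Once `b^n * δ` exceeds the length of `[0,1]`, the iterate oscillates by at most `η / 2` and
still has the mean of `g`. -/
lemma tendsto_iterate_branchAverage (hb : 2 ≤ b) {g : ℝ → ℝ} (hg : Continuous g) :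
    TendstoUniformlyOn (fun n => (branchAverage b)^[n] g) (fun _ => ∫ x in (0 : ℝ)..1, g x) atTop
      (Icc 0 1) := by
  have : NeZero b := ⟨by omega⟩
  rw [Metric.tendstoUniformlyOn_iff]
  intro η hη
  obtain ⟨δ, hδ, hu⟩ := Metric.uniformContinuousOn_iff.1
    (isCompact_Icc.uniformContinuousOn_of_continuous (hg.continuousOn (s := Icc (0 : ℝ) 1)))
    (η / 2) (by positivity)
  have ht : Tendsto (fun n : ℕ => (b : ℝ) ^ n * δ) atTop atTop :=
    (tendsto_pow_atTop_atTop_of_one_lt (by exact_mod_cast (by omega : 1 < b))).atTop_mul_const hδ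
  filter_upwards [ht.eventually_gt_atTop 1] with n hn x hx
  have hosc := abs_iterate_branchAverage_sub_le (b := b) (g := g) (δ := δ) (η := η / 2)
    (fun x hx y hy h => (hu x hx y hy h).le) n
  have hc := continuous_iterate_branchAverage (b := b) hg n
  rw [← integral_iterate_branchAverage (b := b) hg n, Real.dist_eq]
  have : (∫ y in (0 : ℝ)..1, (branchAverage b)^[n] g y) - (branchAverage b)^[n] g x =
      ∫ y in (0 : ℝ)..1, ((branchAverage b)^[n] g y - (branchAverage b)^[n] g x) := by
    rw [intervalIntegral.integral_sub (hc.intervalIntegrable _ _) (by simp)]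
    simp
  rw [this]
  have h := intervalIntegral.norm_integral_le_of_norm_le_const (a := (0 : ℝ)) (b := 1) (C := η / 2)
    (f := fun y => (branchAverage b)^[n] g y - (branchAverage b)^[n] g x) ?_
  · rw [Real.norm_eq_abs] at h
    simp at h
    linarith
  · intro y hy
    rw [uIoc_of_le zero_le_one] at hy
    refine hosc y (Ioc_subset_Icc_self hy) x hx (lt_of_le_of_lt ?_ hn)
    rw [abs_le]
    constructor <;> linarith [hy.1, hy.2, hx.1, hx.2]

end Averaging

/-! ### The Bernoulli measure and the Markov chain of angles -/

section Bernoulli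

variable {b : ℕ}

lemma measurable_update_pair (i : ℤ) :
    Measurable (fun p : Fin b × BiSeq b => Function.update p.2 i p.1) := by
  refine measurable_pi_lambda _ fun j => ?_
  by_cases h : j = i
  · subst h; simpa using measurable_fst
  · simp only [Function.update_of_ne h]; fun_prop

lemma lintegral_uniformOn_fin (F : Fin b → ℝ≥0∞) :
    ∫⁻ x, F x ∂(ProbabilityTheory.uniformOn (univ : Set (Fin b))) = (∑ x, F x) / b := by
  rw [lintegral_fintype, ENNReal.div_eq_inv_mul, Finset.mul_sum]
  refine Finset.sum_congr rfl fun x _ => ?_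
  rw [ProbabilityTheory.uniformOn_univ]
  simp [mul_comm]

lemma angle_update_of_lt {k : ℕ} {i : ℤ} (hi : i < -k) (ε : BiSeq b) (x : Fin b) :
    angle k (Function.update ε i x) = angle k ε := by
  unfold angle
  congr 1
  funext j
  rw [Function.update_of_ne (by omega)]

lemma angle_succ_update (k : ℕ) (ε : BiSeq b) (x : Fin b) :
    angle (k + 1) (Function.update ε (-(k + 1 : ℤ)) x) = ((x : ℕ) + angle k ε) / b := by
  rw [angle_succ, angle_update_of_lt (by omega), Function.update_self]

lemma measurable_angle (k : ℕ) : Measurable (angle (b := b) k) := (continuous_angle k).measurable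

variable [NeZero b]

instance isProbabilityMeasure_uniformOn_fin :
    IsProbabilityMeasure (ProbabilityTheory.uniformOn (univ : Set (Fin b))) :=
  ProbabilityTheory.isProbabilityMeasure_uniformOn finite_univ univ_nonempty

instance isProbabilityMeasure_bernoulliMeasure : IsProbabilityMeasure (bernoulliMeasure b) := by
  unfold bernoulliMeasure
  infer_instance

/-- Resampling one coordinate preserves the Bernoulli measure. -/
lemma map_update_bernoulliMeasure (i : ℤ) :
    ((ProbabilityTheory.uniformOn (univ : Set (Fin b))).prod (bernoulliMeasure b)).map
      (fun p => Function.update p.2 i p.1) = bernoulliMeasure b := by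
  refine Measure.eq_infinitePi _ fun s t ht => ?_
  rw [Measure.map_apply (measurable_update_pair i)
    (MeasurableSet.pi s.countable_toSet fun j _ => ht j)]
  have : (fun p : Fin b × BiSeq b => Function.update p.2 i p.1) ⁻¹' (Set.pi s t) =
      (if i ∈ s then t i else univ) ×ˢ Set.pi (s.erase i : Finset ℤ) t := by
    ext ⟨x, ε⟩
    simp only [mem_preimage, Set.mem_pi, mem_prod, Finset.coe_erase, Finset.mem_coe,
      Set.mem_sdiff, mem_singleton_iff]
    constructor
    · intro h
      refine ⟨?_, fun j hj => by simpa [Function.update_of_ne hj.2] using h j hj.1⟩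
      split_ifs with hi
      · simpa using h i hi
      · trivial
    · rintro ⟨h1, h2⟩ j hj
      by_cases hji : j = i
      · subst hji
        simpa [hj] using h1
      · rw [Function.update_of_ne hji]
        exact h2 j ⟨hj, hji⟩
  rw [this, Measure.prod_prod, bernoulliMeasure, Measure.infinitePi_pi _ fun j _ => ht j]
  by_cases hi : i ∈ s
  · rw [if_pos hi, Finset.mul_prod_erase s
      (fun j => (ProbabilityTheory.uniformOn (univ : Set (Fin b))) (t j)) hi]
  · rw [if_neg hi, measure_univ, one_mul, Finset.erase_eq_of_notMem hi]

/-- Independence in usable form: one coordinate is averaged while all others are held fixed. -/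
lemma lintegral_resample (i : ℤ) {F : BiSeq b → ℝ≥0∞} (hF : Measurable F) :
    ∫⁻ ε, F ε ∂(bernoulliMeasure b) =
      ∫⁻ ε, (∑ x, F (Function.update ε i x)) / b ∂(bernoulliMeasure b) := by
  conv_lhs => rw [← map_update_bernoulliMeasure i]
  rw [lintegral_map hF (measurable_update_pair i), lintegral_prod_symm'
    (fun p : Fin b × BiSeq b => F (Function.update p.2 i p.1))
    (hF.comp (measurable_update_pair i))]
  refine lintegral_congr fun ε => ?_
  rw [lintegral_uniformOn_fin]

lemma map_shift_bernoulliMeasure (k : ℤ) :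
    (bernoulliMeasure b).map (fun ε j => ε (j - k)) = bernoulliMeasure b := by
  have := Measure.infinitePi_map_piCongrLeft
    (μ := fun _ : ℤ => ProbabilityTheory.uniformOn (univ : Set (Fin b))) (Equiv.addRight k)
  convert! this using 2
  funext ε j
  rw [MeasurableEquiv.coe_piCongrLeft]
  have h := Equiv.piCongrLeft_apply_apply (fun _ : ℤ => Fin b) (Equiv.addRight k) ε (j - k)
  simpa using h.symm

lemma integral_resample (i : ℤ) {F : BiSeq b → ℝ} (hF : Integrable F (bernoulliMeasure b)) :
    ∫ ε, F ε ∂(bernoulliMeasure b) =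
      ∫ ε, (∑ x, F (Function.update ε i x)) / b ∂(bernoulliMeasure b) := by
  have hm := measurable_update_pair (b := b) i
  have hF' := hF
  rw [← map_update_bernoulliMeasure i] at hF'
  conv_lhs => rw [← map_update_bernoulliMeasure i]
  rw [integral_map hm.aemeasurable hF'.aestronglyMeasurable, integral_prod_symm
    (fun p : Fin b × BiSeq b => F (Function.update p.2 i p.1)) (hF'.comp_measurable hm)]
  refine integral_congr_ae (Eventually.of_forall fun ε => ?_)
  simp only
  rw [integral_fintype (Integrable.of_finite), Finset.sum_div]
  refine Finset.sum_congr rfl fun x _ => ?_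
  rw [measureReal_def, ProbabilityTheory.uniformOn_univ]
  simp [div_eq_inv_mul]

lemma integral_angle_succ (k : ℕ) {g : ℝ → ℝ} (hg : Continuous g) :
    ∫ ε, g (angle (k + 1) ε) ∂(bernoulliMeasure b) =
      ∫ ε, branchAverage b g (angle k ε) ∂(bernoulliMeasure b) := by
  obtain ⟨C, hC⟩ := isCompact_Icc.exists_bound_of_continuousOn (hg.continuousOn (s := Icc (0 : ℝ) 1))
  rw [integral_resample (-(k + 1 : ℤ)) (F := fun ε => g (angle (k + 1) ε))]
  · refine integral_congr_ae (Eventually.of_forall fun ε => ?_)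
    simp only [angle_succ_update, branchAverage]
  · exact Integrable.of_bound (hg.comp (continuous_angle _)).aestronglyMeasurable C
      (Eventually.of_forall fun ε => hC _ (angle_mem_Icc _ _))

lemma integral_angle_iterate (n : ℕ) {g : ℝ → ℝ} (hg : Continuous g) :
    ∫ ε, g (angle n ε) ∂(bernoulliMeasure b) =
      ∫ ε, (branchAverage b)^[n] g (angle 0 ε) ∂(bernoulliMeasure b) := by
  induction n generalizing g with
  | zero => rfl
  | succ n ih =>
    rw [integral_angle_succ n hg, ih (continuous_branchAverage hg), Function.iterate_succ_apply]

lemma map_angle_eq (k : ℕ) :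
    (bernoulliMeasure b).map (angle k) = (bernoulliMeasure b).map (angle 0) := by
  conv_rhs => rw [← map_shift_bernoulliMeasure (k : ℤ)]
  rw [Measure.map_map (measurable_angle 0) (by fun_prop)]
  congr 1

/-- The angles of the coded inverse orbits are uniformly distributed. -/
lemma map_angle (hb : 2 ≤ b) (k : ℕ) :
    (bernoulliMeasure b).map (angle k) = volume.restrict (Ioc 0 1) := by
  rw [map_angle_eq]
  have : IsProbabilityMeasure ((bernoulliMeasure b).map (angle 0)) :=
    Measure.isProbabilityMeasure_map (measurable_angle 0).aemeasurable
  refine ext_of_forall_integral_eq_of_IsFiniteMeasure fun g => ?_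
  have hg := g.continuous
  rw [← intervalIntegral.integral_of_le zero_le_one]
  -- By shift invariance all angles have the same law, so the integral of `g` equals that of every
  -- iterated average, and these tend uniformly to the Lebesgue mean.
  have hn : ∀ n : ℕ, ∫ x, g x ∂(bernoulliMeasure b).map (angle 0) =
      ∫ ε, (branchAverage b)^[n] g (angle 0 ε) ∂(bernoulliMeasure b) := by
    intro n
    rw [← map_angle_eq n, integral_map (measurable_angle n).aemeasurable
      hg.aestronglyMeasurable, integral_angle_iterate n hg]
  have hunif := Metric.tendstoUniformlyOn_iff.1 (tendsto_iterate_branchAverage hb hg)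
  refine eq_of_abs_sub_le_all fun η hη => ?_
  obtain ⟨n, hn'⟩ := (hunif η hη).exists
  rw [hn n]
  have hc := (continuous_iterate_branchAverage (b := b) hg n).comp (continuous_angle (b := b) 0)
  obtain ⟨C, hC⟩ := isCompact_Icc.exists_bound_of_continuousOn
    ((continuous_iterate_branchAverage (b := b) hg n).continuousOn (s := Icc (0 : ℝ) 1))
  have hi : Integrable (fun ε => (branchAverage b)^[n] g (angle 0 ε)) (bernoulliMeasure b) :=
    Integrable.of_bound hc.aestronglyMeasurable C
      (Eventually.of_forall fun ε => hC _ (angle_mem_Icc _ _))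
  have : (∫ ε, (branchAverage b)^[n] g (angle 0 ε) ∂(bernoulliMeasure b)) -
      ∫ x in (0 : ℝ)..1, g x = ∫ ε, ((branchAverage b)^[n] g (angle 0 ε) -
        ∫ x in (0 : ℝ)..1, g x) ∂(bernoulliMeasure b) := by
    rw [integral_sub hi (integrable_const _)]
    simp
  rw [this, ← Real.norm_eq_abs]
  refine (norm_integral_le_of_norm_le_const (C := η) (Eventually.of_forall fun ε => ?_)).trans_eq
    (by simp)
  rw [← dist_eq_norm, dist_comm]
  exact (hn' _ (angle_mem_Icc _ _)).le

/-- One Markov step: neither `A` nor `angle k` sees the digit at `-(k + 1)`, so averaging it out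
applies `hstep` at `x = angle k ε`. -/
lemma lintegral_mul_exp_angle_succ_le {k : ℕ} {A : BiSeq b → ℝ≥0∞} (hA : Measurable A)
    (hAk : ∀ ε x, A (Function.update ε (-(k + 1 : ℤ)) x) = A ε) {u v : ℝ → ℝ} (hu : Continuous u)
    {q : ℝ} (hq : 0 ≤ q)
    (hstep : ∀ x ∈ Icc (0 : ℝ) 1,
      ∑ i : Fin b, Real.exp (u (((i : ℕ) + x) / b)) ≤ b * q * Real.exp (v x)) :
    ∫⁻ ε, A ε * ENNReal.ofReal (Real.exp (u (angle (k + 1) ε))) ∂(bernoulliMeasure b) ≤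
      ENNReal.ofReal q *
        ∫⁻ ε, A ε * ENNReal.ofReal (Real.exp (v (angle k ε))) ∂(bernoulliMeasure b) := by
  have hm : Measurable fun ε : BiSeq b =>
      A ε * ENNReal.ofReal (Real.exp (u (angle (k + 1) ε))) :=
    hA.mul (Real.measurable_exp.comp (hu.measurable.comp (measurable_angle _))).ennreal_ofReal
  rw [lintegral_resample (-(k + 1 : ℤ)) hm, ← lintegral_const_mul' _ _ ENNReal.ofReal_ne_top]
  refine lintegral_mono fun ε => ?_
  simp only [hAk, angle_succ_update]
  have hb0 : (b : ℝ≥0∞) ≠ 0 := by exact_mod_cast NeZero.ne b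
  rw [← Finset.mul_sum, ← ENNReal.ofReal_sum_of_nonneg (fun i _ => (Real.exp_pos _).le)]
  have h := ENNReal.ofReal_le_ofReal (hstep _ (angle_mem_Icc k ε))
  rw [ENNReal.ofReal_mul (by positivity), ENNReal.ofReal_mul (by positivity),
    ENNReal.ofReal_natCast] at h
  refine ENNReal.div_le_of_le_mul ?_
  calc _ ≤ A ε * (b * ENNReal.ofReal q * ENNReal.ofReal (Real.exp (v (angle k ε)))) := by gcongr
    _ = _ := by ring

lemma lintegral_mul_exp_sum_angle_le {K : ℕ} {A : BiSeq b → ℝ≥0∞} (hA : Measurable A)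
    (hAK : ∀ i : ℤ, i < -K → ∀ ε x, A (Function.update ε i x) = A ε)
    {w v : ℝ → ℝ} (hw : Continuous w) (hv : Continuous v) {q : ℝ} (hq : 0 ≤ q)
    (hstep : ∀ x ∈ Icc (0 : ℝ) 1,
      ∑ i : Fin b, Real.exp (w (((i : ℕ) + x) / b) + v (((i : ℕ) + x) / b)) ≤
        b * q * Real.exp (v x)) (n : ℕ) :
    ∫⁻ ε, A ε * ENNReal.ofReal (Real.exp
        (∑ j ∈ Finset.range n, w (angle (K + j + 1) ε) + v (angle (K + n) ε)))
          ∂(bernoulliMeasure b) ≤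
      ENNReal.ofReal q ^ n *
        ∫⁻ ε, A ε * ENNReal.ofReal (Real.exp (v (angle K ε))) ∂(bernoulliMeasure b) := by
  induction n with
  | zero => simp
  | succ n ih =>
    have hm : Measurable fun ε : BiSeq b => A ε * ENNReal.ofReal (Real.exp
        (∑ j ∈ Finset.range n, w (angle (K + j + 1) ε))) := by
      refine hA.mul (Continuous.measurable ?_).ennreal_ofReal
      have := fun k => continuous_angle (b := b) k
      fun_prop
    have h := lintegral_mul_exp_angle_succ_le (k := K + n) hm ?_ (hw.add hv) hq hstep
    · have e1 : ∀ ε : BiSeq b, A ε * ENNReal.ofReal (Real.exp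
          (∑ j ∈ Finset.range (n + 1), w (angle (K + j + 1) ε) + v (angle (K + (n + 1)) ε))) =
          A ε * ENNReal.ofReal (Real.exp (∑ j ∈ Finset.range n, w (angle (K + j + 1) ε))) *
            ENNReal.ofReal (Real.exp ((w + v) (angle (K + n + 1) ε))) := by
        intro ε
        rw [mul_assoc, ← ENNReal.ofReal_mul (Real.exp_pos _).le, ← Real.exp_add,
          Finset.sum_range_succ, Pi.add_apply, add_assoc, add_assoc]
      have e2 : ∀ ε : BiSeq b, A ε * ENNReal.ofReal (Real.exp
          (∑ j ∈ Finset.range n, w (angle (K + j + 1) ε))) *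
            ENNReal.ofReal (Real.exp (v (angle (K + n) ε))) = A ε * ENNReal.ofReal (Real.exp
          (∑ j ∈ Finset.range n, w (angle (K + j + 1) ε) + v (angle (K + n) ε))) := by
        intro ε
        rw [mul_assoc, ← ENNReal.ofReal_mul (Real.exp_pos _).le, ← Real.exp_add]
      simp_rw [e1]
      simp_rw [e2] at h
      refine h.trans ?_
      rw [pow_succ', mul_assoc]
      gcongr
    · intro ε x
      rw [hAK _ (by push_cast; omega)]
      have : ∀ j ∈ Finset.range n,
          w (angle (K + j + 1) (Function.update ε (-((K + n : ℕ) + 1 : ℤ)) x)) =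
            w (angle (K + j + 1) ε) := by
        intro j hj
        have := Finset.mem_range.1 hj
        rw [angle_update_of_lt (by push_cast; omega)]
      rw [Finset.sum_congr rfl this]

end Bernoulli

/-! ### Coboundary correction and exponential contraction -/

section Corrector

variable {b : ℕ}

lemma branchAverage_add (g h : ℝ → ℝ) :
    branchAverage b (g + h) = branchAverage b g + branchAverage b h := by
  funext x
  simp [branchAverage, Finset.sum_add_distrib, add_div]

lemma branchAverage_sum_iterate (g : ℝ → ℝ) (m : ℕ) :
    branchAverage b (∑ j ∈ Finset.range m, (branchAverage b)^[j] g) =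
      ∑ j ∈ Finset.range m, (branchAverage b)^[j + 1] g := by
  induction m with
  | zero => funext x; simp [branchAverage]
  | succ m ih =>
    rw [Finset.sum_range_succ, branchAverage_add, ih, Finset.sum_range_succ,
      Function.iterate_succ_apply' _ m]

/-- A function of positive mean is, up to a coboundary, positive on average over the
inverse branches. -/
lemma exists_corrector (hb : 2 ≤ b) {g : ℝ → ℝ} (hg : Continuous g)
    (hpos : 0 < ∫ x in (0 : ℝ)..1, g x) :
    ∃ v : ℝ → ℝ, Continuous v ∧ ∃ c > 0, ∀ x ∈ Icc (0 : ℝ) 1,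
      c ≤ branchAverage b (g + v) x - v x := by
  obtain ⟨n, hn, hn1⟩ := ((Metric.tendstoUniformlyOn_iff.1 (tendsto_iterate_branchAverage hb hg)
    ((∫ x in (0 : ℝ)..1, g x) / 2) (by positivity)).and (eventually_ge_atTop 1)).exists
  obtain ⟨m, rfl⟩ : ∃ m, n = m + 1 := ⟨n - 1, by omega⟩
  -- With `L` the branch average and `v = L g + ⋯ + L^m g`, the difference `L (g + v) - v`
  -- telescopes to `L^(m+1) g`, which is uniformly close to the mean.
  refine ⟨∑ j ∈ Finset.range m, (branchAverage b)^[j + 1] g, ?_, _, half_pos hpos, ?_⟩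
  · rw [Finset.sum_fn]
    exact continuous_finsetSum _ fun j _ => continuous_iterate_branchAverage hg _
  · intro x hx
    have e : g + ∑ j ∈ Finset.range m, (branchAverage b)^[j + 1] g =
        ∑ j ∈ Finset.range (m + 1), (branchAverage b)^[j] g := by
      rw [Finset.sum_range_succ', add_comm]
      rfl
    rw [e, branchAverage_sum_iterate, Finset.sum_range_succ, Pi.add_apply, add_sub_cancel_left]
    have := hn x hx
    rw [Real.dist_eq, abs_lt] at this
    linarith [this.2]

lemma exists_exponential_contraction (hb : 2 ≤ b) {g : ℝ → ℝ} (hg : Continuous g)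
    (hpos : 0 < ∫ x in (0 : ℝ)..1, g x) :
    ∃ v : ℝ → ℝ, Continuous v ∧ ∃ κ₁ > 0, ∀ κ, 0 < κ → κ < κ₁ → ∃ q, 0 ≤ q ∧ q < 1 ∧
      ∀ x ∈ Icc (0 : ℝ) 1,
        ∑ i : Fin b, Real.exp (-κ * g (((i : ℕ) + x) / b) + -κ * v (((i : ℕ) + x) / b)) ≤
          b * q * Real.exp (-κ * v x) := by
  obtain ⟨v, hv, c, hc, hcv⟩ := exists_corrector hb hg hpos
  have hb0 : (0 : ℝ) < b := by positivity
  obtain ⟨M₁, hM₁⟩ := isCompact_Icc.exists_bound_of_continuousOn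
    ((hg.add hv).continuousOn (s := Icc (0 : ℝ) 1))
  obtain ⟨M₂, hM₂⟩ := isCompact_Icc.exists_bound_of_continuousOn
    (hv.continuousOn (s := Icc (0 : ℝ) 1))
  set M := max 1 (M₁ + M₂) with hM
  have hM1 : 1 ≤ M := le_max_left _ _
  -- The bound `1 / M` permits the second-order estimate of the exponential; `c / M^2` makes the
  -- linear gain `κ c` exceed the error `κ^2 M^2`.
  refine ⟨v, hv, min (1 / M) (c / M ^ 2), by positivity, fun κ hκ hκ1 => ?_⟩
  have h1 : κ * M ≤ 1 := by
    have := (hκ1.trans_le (min_le_left _ _)).le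
    rwa [le_div_iff₀ (by positivity)] at this
  have h2 : κ * M ^ 2 < c := by
    have := hκ1.trans_le (min_le_right _ _)
    rwa [lt_div_iff₀ (by positivity)] at this
  refine ⟨max 0 (1 - κ * c + κ ^ 2 * M ^ 2), le_max_left _ _, max_lt one_pos (by nlinarith),
    fun x hx => ?_⟩
  set D : Fin b → ℝ := fun i => g (((i : ℕ) + x) / b) + v (((i : ℕ) + x) / b) - v x with hD
  have hDM : ∀ i, |D i| ≤ M := by
    intro i
    have h3 := hM₁ _ (inverse_branch_mem_Icc i hx)
    have h4 := hM₂ _ hx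
    rw [Real.norm_eq_abs] at h3 h4
    exact (abs_sub _ _).trans ((add_le_add h3 h4).trans (le_max_right _ _))
  have hexp : ∀ i : Fin b, Real.exp (-κ * g (((i : ℕ) + x) / b) + -κ * v (((i : ℕ) + x) / b)) =
      Real.exp (-κ * D i) * Real.exp (-κ * v x) := by
    intro i
    rw [← Real.exp_add]
    congr 1
    simp only [hD]
    ring
  have hle : ∀ i, Real.exp (-κ * D i) ≤ 1 - κ * D i + κ ^ 2 * M ^ 2 := by
    intro i
    have h5 : |-κ * D i| ≤ κ * M := by
      rw [abs_mul, abs_neg, abs_of_pos hκ]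
      exact mul_le_mul_of_nonneg_left (hDM i) hκ.le
    have h6 := (abs_le.1 (Real.abs_exp_sub_one_sub_id_le (h5.trans h1))).2
    have h7 : (-κ * D i) ^ 2 ≤ (κ * M) ^ 2 := sq_le_sq' (neg_le_of_abs_le h5) (le_of_abs_le h5)
    nlinarith
  have hsum : (∑ i, D i) / b = branchAverage b (g + v) x - v x := by
    simp only [hD, branchAverage, Finset.sum_sub_distrib, Pi.add_apply]
    simp
    field_simp
  have hcb : b * c ≤ ∑ i, D i := by
    have := hcv x hx
    rw [← hsum, le_div_iff₀ hb0] at this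
    linarith
  rw [Finset.sum_congr rfl fun i _ => hexp i, ← Finset.sum_mul]
  gcongr
  calc ∑ i, Real.exp (-κ * D i) ≤ ∑ i, (1 - κ * D i + κ ^ 2 * M ^ 2) :=
        Finset.sum_le_sum fun i _ => hle i
    _ = b - κ * ∑ i, D i + b * (κ ^ 2 * M ^ 2) := by
        rw [Finset.sum_add_distrib, Finset.sum_sub_distrib, ← Finset.mul_sum]
        simp
    _ ≤ b * (1 - κ * c + κ ^ 2 * M ^ 2) := by nlinarith
    _ ≤ _ := by gcongr; exact le_max_right _ _

end Corrector

/-! ### Distance to a line through the origin -/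

section RayDistance

/-- The distance of `a` from the line through `0` with argument `2πθ`. -/
noncomputable def lineDist (a : ℂ) (θ : ℝ) : ℝ :=
  ‖a‖ * |Real.sin (2 * Real.pi * θ - Complex.arg a)|

lemma lineDist_nonneg (a : ℂ) (θ : ℝ) : 0 ≤ lineDist a θ := by
  unfold lineDist
  positivity

lemma continuous_lineDist (a : ℂ) : Continuous (lineDist a) := by
  unfold lineDist
  fun_prop

/-- After rotation by `-θ` the point `ρ` is real, and the imaginary part of the difference does not
involve `ρ`. -/
lemma lineDist_le (a : ℂ) (ρ θ : ℝ) : lineDist a θ ≤ ‖(ρ : ℂ) * circlePoint θ - a‖ := by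
  have h1 : ‖(ρ : ℂ) * circlePoint θ - a‖ = ‖(ρ : ℂ) - a * circlePoint (-θ)‖ := by
    have h2 : circlePoint θ * circlePoint (-θ) = 1 := by
      rw [circlePoint, circlePoint, ← Complex.exp_add]
      simp
    calc ‖(ρ : ℂ) * circlePoint θ - a‖
        = ‖(ρ : ℂ) * circlePoint θ - a‖ * ‖circlePoint (-θ)‖ := by
          rw [norm_circlePoint, mul_one]
      _ = ‖(ρ : ℂ) * (circlePoint θ * circlePoint (-θ)) - a * circlePoint (-θ)‖ := by
          rw [← norm_mul]; ring_nf
      _ = _ := by rw [h2, mul_one]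
  have h3 : a * circlePoint (-θ) =
      (‖a‖ : ℂ) * Complex.exp ((Complex.arg a - 2 * Real.pi * θ : ℝ) * Complex.I) := by
    conv_lhs => rw [← Complex.norm_mul_exp_arg_mul_I a]
    rw [circlePoint, mul_assoc, ← Complex.exp_add]
    congr 2
    push_cast
    ring
  rw [h1]
  refine le_trans (le_of_eq ?_) (Complex.abs_im_le_norm _)
  rw [h3, Complex.sub_im, Complex.ofReal_im, Complex.im_ofReal_mul, Complex.exp_ofReal_mul_I_im,
    zero_sub, abs_neg, abs_mul, abs_of_nonneg (norm_nonneg a), lineDist, ← abs_neg, ← Real.sin_neg,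
    neg_sub]

/-- Jordan's inequality `sin x ≥ 2 x / π` on the first quarter period, then reflection and
periodicity. -/
lemma intervalIntegrable_abs_sin_rpow {p : ℝ} (hp0 : 0 ≤ p) (hp : p < 1) (s t : ℝ) :
    IntervalIntegrable (fun x => |Real.sin x| ^ (-p)) volume s t := by
  have hper : Function.Periodic (fun x => |Real.sin x| ^ (-p)) Real.pi := by
    intro x
    simp [Real.sin_add_pi]
  have hmeas : Measurable (fun x => |Real.sin x| ^ (-p)) := by fun_prop
  have h1 : IntervalIntegrable (fun x => |Real.sin x| ^ (-p)) volume 0 (Real.pi / 2) := by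
    have h0 : IntervalIntegrable (fun x : ℝ => (2 / Real.pi) ^ (-p) * x ^ (-p)) volume 0
        (Real.pi / 2) :=
      (intervalIntegral.intervalIntegrable_rpow' (by linarith)).const_mul _
    refine h0.mono_fun' hmeas.aestronglyMeasurable ?_
    rw [uIoc_of_le (by positivity)]
    filter_upwards [ae_restrict_mem measurableSet_Ioc] with x hx
    have h2 := Real.mul_le_sin hx.1.le hx.2
    have hpi := Real.pi_pos
    have hx0 := hx.1
    have h3 : 0 < 2 / Real.pi * x := by positivity
    rw [Real.norm_eq_abs, abs_of_nonneg (by positivity), ← Real.mul_rpow (by positivity) hx.1.le,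
      abs_of_nonneg (h3.le.trans h2)]
    exact Real.rpow_le_rpow_of_nonpos h3 h2 (by linarith)
  have h2 : IntervalIntegrable (fun x => |Real.sin x| ^ (-p)) volume (Real.pi / 2) Real.pi := by
    have := (h1.comp_sub_left Real.pi).symm
    simp only [Real.sin_pi_sub, sub_zero] at this
    rwa [show Real.pi - Real.pi / 2 = Real.pi / 2 by ring] at this
  refine hper.intervalIntegrable (t := 0) Real.pi_ne_zero ?_ s t
  rw [zero_add]
  exact h1.trans h2

lemma integrable_lineDist_rpow {a : ℂ} {p : ℝ} (hp0 : 0 ≤ p) (hp : p < 1) :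
    Integrable (fun θ => (lineDist a θ) ^ (-p)) (volume.restrict (Ioc (0 : ℝ) 1)) := by
  have h := intervalIntegrable_abs_sin_rpow hp0 hp (-Complex.arg a) (2 * Real.pi - Complex.arg a)
  have h1 := (h.comp_sub_right (Complex.arg a)).comp_mul_left (c := 2 * Real.pi)
  have h2 := h1.const_mul (‖a‖ ^ (-p))
  rw [show (-Complex.arg a + Complex.arg a) / (2 * Real.pi) = 0 by simp,
    show (2 * Real.pi - Complex.arg a + Complex.arg a) / (2 * Real.pi) = 1 by
      field_simp; ring, intervalIntegrable_iff_integrableOn_Ioc_of_le zero_le_one] at h2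
  refine h2.congr (Eventually.of_forall fun θ => ?_)
  simp only [lineDist]
  rw [Real.mul_rpow (norm_nonneg _) (abs_nonneg _)]

lemma ae_lineDist_ne_zero {a : ℂ} (ha : a ≠ 0) : ∀ᵐ θ : ℝ, lineDist a θ ≠ 0 := by
  have hc : (range fun n : ℤ => (n * Real.pi + Complex.arg a) / (2 * Real.pi)).Countable :=
    countable_range _
  filter_upwards [hc.ae_notMem volume] with θ hθ h0
  rw [lineDist, mul_eq_zero, norm_eq_zero, abs_eq_zero, or_iff_right ha, Real.sin_eq_zero_iff] at h0
  obtain ⟨n, hn⟩ := h0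
  refine hθ ⟨n, ?_⟩
  simp only [hn]
  have := Real.pi_pos
  field_simp
  ring

end RayDistance

/-! ### Lower bounds near the zeros -/

section ZeroBound

variable {B : ℂ → ℂ}

lemma half_norm_sub_le_one {a z : ℂ} (ha : ‖a‖ < 1) (hz : z ∈ Metric.closedBall (0 : ℂ) 1) :
    ‖z - a‖ / 2 ≤ 1 := by
  have := norm_sub_le z a
  have := mem_closedBall_zero_iff.1 hz
  linarith

lemma not_eventually_zero (hc : ContinuousOn B (Metric.closedBall 0 1))
    (hd : DifferentiableOn ℂ B (Metric.ball 0 1)) (hne : ∀ z ∈ Metric.sphere (0 : ℂ) 1, B z ≠ 0)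
    {p : ℂ} (hp : p ∈ Metric.ball (0 : ℂ) 1) : ¬ ∀ᶠ z in 𝓝 p, B z = 0 := by
  intro h
  have h1 : EqOn B 0 (Metric.ball 0 1) :=
    (hd.analyticOnNhd Metric.isOpen_ball).eqOn_zero_of_preconnected_of_eventuallyEq_zero
      (convex_ball _ _).isPreconnected hp h
  have h2 : EqOn B 0 (Metric.closedBall 0 1) :=
    h1.of_subset_closure hc continuousOn_const Metric.ball_subset_closedBall
      (by rw [closure_ball (0 : ℂ) one_ne_zero])
  exact hne 1 (by simp) (h2 (by simp))

/-- A lower bound by the distances to finitely many points of the open disk. -/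
lemma exists_lower_bound (hc : ContinuousOn B (Metric.closedBall 0 1))
    (hd : DifferentiableOn ℂ B (Metric.ball 0 1))
    (hne : ∀ z ∈ Metric.sphere (0 : ℂ) 1, B z ≠ 0) :
    ∃ c > 0, ∃ m : ℕ, ∃ Z : Finset ℂ, (∀ a ∈ Z, ‖a‖ < 1) ∧
      ∀ z ∈ Metric.closedBall (0 : ℂ) 1, c * ∏ a ∈ Z, (‖z - a‖ / 2) ^ m ≤ ‖B z‖ := by
  suffices H : ∃ c > 0, ∃ m : ℕ, ∃ Z : Finset ℂ, (∀ a ∈ Z, ‖a‖ < 1) ∧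
      ∀ z ∈ Metric.closedBall (0 : ℂ) 1, z ∈ Metric.closedBall (0 : ℂ) 1 →
        c * ∏ a ∈ Z, (‖z - a‖ / 2) ^ m ≤ ‖B z‖ by
    obtain ⟨c, h1, m, Z, h2, h3⟩ := H
    exact ⟨c, h1, m, Z, h2, fun z hz => h3 z hz hz⟩
  -- Halved distances are at most `1`, so enlarging `Z` or `m` and shrinking `c` keeps a bound
  -- valid; this lets local bounds be merged.
  refine (isCompact_closedBall (0 : ℂ) 1).induction_on
    (p := fun s => ∃ c > 0, ∃ m : ℕ, ∃ Z : Finset ℂ, (∀ a ∈ Z, ‖a‖ < 1) ∧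
      ∀ z ∈ s, z ∈ Metric.closedBall (0 : ℂ) 1 → c * ∏ a ∈ Z, (‖z - a‖ / 2) ^ m ≤ ‖B z‖)
    ⟨1, one_pos, 0, ∅, by simp, by simp⟩ ?_ ?_ ?_
  · rintro s t hst ⟨c, h1, m, Z, h2, h3⟩
    exact ⟨c, h1, m, Z, h2, fun z hz => h3 z (hst hz)⟩
  · rintro s t ⟨c, h1, m, Z, h2, h3⟩ ⟨c', h1', m', Z', h2', h3'⟩
    have key : ∀ {Z Z' : Finset ℂ} {m m' : ℕ} {c c' : ℝ} {z : ℂ}, 0 < c → 0 < c' →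
        (∀ a ∈ Z, ‖a‖ < 1) → (∀ a ∈ Z', ‖a‖ < 1) → z ∈ Metric.closedBall (0 : ℂ) 1 →
        Z ⊆ Z' → m ≤ m' → c' ≤ c →
        c' * ∏ a ∈ Z', (‖z - a‖ / 2) ^ m' ≤ c * ∏ a ∈ Z, (‖z - a‖ / 2) ^ m := by
      intro Z Z' m m' c c' z hc hc' hZ hZ' hz hs hm hcc
      rw [← Finset.prod_sdiff hs]
      have i1 : ∏ a ∈ Z' \ Z, (‖z - a‖ / 2) ^ m' ≤ 1 := Finset.prod_le_one
        (fun _ _ => by positivity) fun a ha => pow_le_one₀ (by positivity)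
          (half_norm_sub_le_one (hZ' a (Finset.mem_sdiff.1 ha).1) hz)
      have i2 : ∏ a ∈ Z, (‖z - a‖ / 2) ^ m' ≤ ∏ a ∈ Z, (‖z - a‖ / 2) ^ m :=
        Finset.prod_le_prod (fun _ _ => by positivity) fun a ha =>
          pow_le_pow_of_le_one (by positivity) (half_norm_sub_le_one (hZ a ha) hz) hm
      have i3 : 0 ≤ ∏ a ∈ Z, (‖z - a‖ / 2) ^ m' := Finset.prod_nonneg fun _ _ => by positivity
      calc _ ≤ c * (1 * ∏ a ∈ Z, (‖z - a‖ / 2) ^ m') := by gcongr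
        _ ≤ _ := by rw [one_mul]; gcongr
    have hZu : ∀ a ∈ Z ∪ Z', ‖a‖ < 1 := fun a ha =>
      (Finset.mem_union.1 ha).elim (h2 a) (h2' a)
    have hcm : 0 < min c c' := lt_min h1 h1'
    refine ⟨min c c', hcm, max m m', Z ∪ Z', hZu, ?_⟩
    rintro z (hz | hz) hzb
    · exact (key h1 hcm h2 hZu hzb Finset.subset_union_left (le_max_left _ _)
        (min_le_left _ _)).trans (h3 z hz hzb)
    · exact (key h1' hcm h2' hZu hzb Finset.subset_union_right (le_max_right _ _)
        (min_le_right _ _)).trans (h3' z hz hzb)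
  · intro p hp
    rcases (mem_closedBall_zero_iff.1 hp).lt_or_eq with hp1 | hp1
    · have hpb := mem_ball_zero_iff.2 hp1
      have han : AnalyticAt ℂ B p := hd.analyticAt (Metric.isOpen_ball.mem_nhds hpb)
      obtain ⟨n, g, hg, hg0, hev⟩ := han.exists_eventuallyEq_pow_smul_nonzero_iff.2
        (not_eventually_zero hc hd hne hpb)
      have hgp : 0 < ‖g p‖ := norm_pos_iff.2 hg0
      have hg2 : ∀ᶠ z in 𝓝 p, ‖g p‖ / 2 < ‖g z‖ :=
        hg.continuousAt.norm.eventually (lt_mem_nhds (half_lt_self hgp))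
      refine ⟨_, nhdsWithin_le_nhds (hev.and hg2), ‖g p‖ / 2, half_pos hgp, n, {p}, by simpa, ?_⟩
      rintro z ⟨hz1, hz2⟩ -
      rw [Finset.prod_singleton, hz1, norm_smul, norm_pow, mul_comm]
      have : ‖z - p‖ / 2 ≤ ‖z - p‖ := half_le_self (norm_nonneg _)
      gcongr
    · have hBp : 0 < ‖B p‖ := norm_pos_iff.2 (hne p (mem_sphere_zero_iff_norm.2 hp1))
      have : ∀ᶠ z in 𝓝[Metric.closedBall 0 1] p, ‖B p‖ / 2 < ‖B z‖ :=
        (hc p hp).norm.eventually (lt_mem_nhds (half_lt_self hBp))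
      refine ⟨_, this, ‖B p‖ / 2, half_pos hBp, 0, ∅, by simp, ?_⟩
      intro z hz _
      simpa using (show ‖B p‖ / 2 < ‖B z‖ from hz).le

/-- If `w` is near `a`, then `‖z‖` is at most about `‖a‖^2 < ‖a‖`, so `z` is not near `a`. -/
lemma exists_radial_gap {a : ℂ} (ha0 : a ≠ 0) (ha1 : ‖a‖ < 1) :
    ∃ η : ℝ, 0 < η ∧ η ≤ 1 ∧ ∀ z w : ℂ, ‖z‖ ≤ ‖w‖ ^ 2 → η ≤ ‖z - a‖ / 2 ∨ η ≤ ‖w - a‖ / 2 := by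
  have h0 : 0 < ‖a‖ := norm_pos_iff.2 ha0
  refine ⟨(‖a‖ - ‖a‖ ^ 2) / 16, by nlinarith, by nlinarith, fun z w hzw => ?_⟩
  by_contra! h
  obtain ⟨hz, hw⟩ := h
  have h1 := norm_sub_norm_le a z
  rw [norm_sub_rev] at h1
  have h2 := norm_sub_norm_le w a
  have h3 : ‖w‖ ^ 2 ≤ (‖a‖ + (‖a‖ - ‖a‖ ^ 2) / 8) ^ 2 := by
    apply pow_le_pow_left₀ (norm_nonneg _)
    linarith
  have hα : 0 < ‖a‖ - ‖a‖ ^ 2 := by nlinarith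
  nlinarith

/-- At most one factor is below `η`. The bound is thus linear in the inverses of `t`, whatever the
number of factors. -/
lemma inv_prod_le_of_gap {ι : Type*} [DecidableEq ι] (J : Finset ι) {d t : ι → ℝ} {η : ℝ}
    (hη0 : 0 < η) (hη1 : η ≤ 1) (ht0 : ∀ j ∈ J, 0 < t j) (htd : ∀ j ∈ J, t j ≤ d j)
    (hgap : ∀ i ∈ J, ∀ j ∈ J, i ≠ j → η ≤ d i ∨ η ≤ d j) :
    (∏ j ∈ J, d j)⁻¹ ≤ η⁻¹ ^ J.card * (1 + ∑ j ∈ J, (t j)⁻¹) := by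
  have hsum : 0 ≤ ∑ j ∈ J, (t j)⁻¹ := Finset.sum_nonneg fun j hj => (inv_pos.2 (ht0 j hj)).le
  have hηi : 1 ≤ η⁻¹ := (one_le_inv₀ hη0).2 hη1
  have hd : ∀ j ∈ J, 0 < d j := fun j hj => (ht0 j hj).trans_le (htd j hj)
  have hI : ∀ I ⊆ J, (∀ j ∈ I, η ≤ d j) → ∏ j ∈ I, (d j)⁻¹ ≤ η⁻¹ ^ J.card := by
    intro I hIJ h
    calc ∏ j ∈ I, (d j)⁻¹ ≤ ∏ j ∈ I, η⁻¹ :=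
          Finset.prod_le_prod (fun j hj => (inv_pos.2 (hd j (hIJ hj))).le)
            fun j hj => inv_anti₀ hη0 (h j hj)
      _ = η⁻¹ ^ I.card := by rw [Finset.prod_const]
      _ ≤ _ := pow_le_pow_right₀ hηi (Finset.card_le_card hIJ)
  rw [← Finset.prod_inv_distrib]
  by_cases h : ∃ i ∈ J, d i < η
  · obtain ⟨i, hi, hdi⟩ := h
    rw [← Finset.mul_prod_erase J _ hi]
    have h1 := hI (J.erase i) (Finset.erase_subset _ _) fun j hj =>
      (hgap i hi j (Finset.mem_of_mem_erase hj) (Finset.ne_of_mem_erase hj).symm).resolve_left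
        (not_le.2 hdi)
    have h2 : (d i)⁻¹ ≤ (t i)⁻¹ := inv_anti₀ (ht0 i hi) (htd i hi)
    have h3 : (t i)⁻¹ ≤ ∑ j ∈ J, (t j)⁻¹ :=
      Finset.single_le_sum (f := fun j => (t j)⁻¹) (fun j hj => (inv_pos.2 (ht0 j hj)).le) hi
    have h4 : 0 ≤ ∏ j ∈ J.erase i, (d j)⁻¹ := Finset.prod_nonneg fun j hj =>
      (inv_pos.2 (hd j (Finset.mem_of_mem_erase hj))).le
    rw [mul_comm]
    have h5 : (d i)⁻¹ ≤ 1 + ∑ j ∈ J, (t j)⁻¹ := by linarith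
    have h6 : 0 ≤ (d i)⁻¹ := (inv_pos.2 (hd i hi)).le
    gcongr
  · push Not at h
    refine (hI J subset_rfl h).trans ?_
    refine le_mul_of_one_le_right (by positivity) (by linarith)

end ZeroBound

/-! ### Bounds for `B` along inverse orbits -/

section OrbitBound

variable {b : ℕ}

lemma norm_diskPoint_le_sq (hb : 2 ≤ b) {r : ℝ} (hr : r ∈ Ioc (0 : ℝ) 1) (ε : BiSeq b) {i j : ℕ}
    (hij : i < j) : ‖diskPoint b r ε i‖ ≤ ‖diskPoint b r ε j‖ ^ 2 := by
  have hb0 : b ≠ 0 := by omega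
  have hj := mem_closedBall_zero_iff.1 (diskPoint_mem_closedBall b hr ε j)
  have h : ∀ n, diskPoint b r ε (i + n) ^ b ^ n = diskPoint b r ε i := by
    intro n
    induction n with
    | zero => simp
    | succ n ih => rw [← ih, ← diskPoint_succ_pow hb0 hr.1 ε (i + n), ← pow_mul, pow_succ', add_assoc]
  obtain ⟨n, rfl⟩ := Nat.exists_eq_add_of_lt hij
  rw [← h (n + 1), norm_pow]
  refine pow_le_pow_of_le_one (norm_nonneg _) hj ?_
  calc 2 ≤ b := hb
    _ = b ^ 1 := (pow_one b).symm
    _ ≤ b ^ (n + 1) := Nat.pow_le_pow_right (by omega) (by omega)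

lemma le_norm_diskPoint {δ r : ℝ} (hδ : 0 < δ) (hr : r ∈ Icc δ 1) (ε : BiSeq b) (k : ℕ) :
    δ ^ (((b : ℝ) ^ k)⁻¹) ≤ ‖diskPoint b r ε k‖ := by
  rw [norm_diskPoint b (hδ.le.trans hr.1)]
  exact Real.rpow_le_rpow hδ.le hr.1 (by positivity)

lemma le_norm_diskPoint' {δ r : ℝ} (hb : 2 ≤ b) (hδ : 0 < δ) (hr : r ∈ Icc δ 1) (ε : BiSeq b)
    (k : ℕ) : δ ≤ ‖diskPoint b r ε k‖ := by
  refine le_trans ?_ (le_norm_diskPoint hδ hr ε k)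
  conv_lhs => rw [← Real.rpow_one δ]
  refine Real.rpow_le_rpow_of_exponent_ge hδ (hr.1.trans hr.2) ?_
  exact inv_le_one_of_one_le₀ (one_le_pow₀ (by exact_mod_cast (by omega : 1 ≤ b)))

lemma lineDist_angle_le (a : ℂ) (r : ℝ) (ε : BiSeq b) (k : ℕ) :
    lineDist a (angle k ε) ≤ ‖diskPoint b r ε k - a‖ := lineDist_le a _ _

/-- Product over an initial piece of the orbit of the distances to one point. -/
lemma exists_inv_prod_dist_le (hb : 2 ≤ b) {a : ℂ} (ha : ‖a‖ < 1) (K : ℕ) {δ : ℝ} (hδ : 0 < δ) :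
    ∃ E : ℝ, 0 ≤ E ∧ ∀ r ∈ Icc δ 1, ∀ ε : BiSeq b,
      (a ≠ 0 → ∀ j, lineDist a (angle j ε) ≠ 0) → ∀ k ≤ K,
      (∏ j ∈ Finset.Icc 1 k, ‖diskPoint b r ε j - a‖ / 2)⁻¹ ≤
        E * (1 + ∑ j ∈ Finset.Icc 1 K, (lineDist a (angle j ε))⁻¹) := by
  have hS : ∀ ε : BiSeq b, 0 ≤ ∑ j ∈ Finset.Icc 1 K, (lineDist a (angle j ε))⁻¹ := fun ε =>
    Finset.sum_nonneg fun j _ => inv_nonneg.2 (lineDist_nonneg _ _)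
  -- Every line passes through `0`, so `lineDist` is useless there (its inverse is `0` by
  -- convention); the bound `‖z‖ ≥ δ` on the orbit replaces it.
  by_cases ha0 : a = 0
  · subst ha0
    refine ⟨(max 1 (2 / δ)) ^ K, by positivity, fun r hr ε _ k hk => ?_⟩
    rw [← Finset.prod_inv_distrib]
    calc ∏ j ∈ Finset.Icc 1 k, (‖diskPoint b r ε j - 0‖ / 2)⁻¹
        ≤ ∏ j ∈ Finset.Icc 1 k, max 1 (2 / δ) := by
          refine Finset.prod_le_prod (fun _ _ => by positivity) fun j _ => ?_
          rw [sub_zero, inv_div]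
          refine le_trans ?_ (le_max_right _ _)
          gcongr
          exact le_norm_diskPoint' hb hδ hr ε j
      _ = max 1 (2 / δ) ^ k := by simp
      _ ≤ max 1 (2 / δ) ^ K := pow_le_pow_right₀ (le_max_left _ _) hk
      _ ≤ _ := le_mul_of_one_le_right (by positivity) (by linarith [hS ε])
  · obtain ⟨η, hη0, hη1, hgap⟩ := exists_radial_gap ha0 ha
    refine ⟨η⁻¹ ^ K * 2, by positivity, fun r hr ε hε k hk => ?_⟩
    have hr' : r ∈ Ioc (0 : ℝ) 1 := ⟨hδ.trans_le hr.1, hr.2⟩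
    have hpos : ∀ j, 0 < lineDist a (angle j ε) := fun j =>
      (lineDist_nonneg _ _).lt_of_ne' (hε ha0 j)
    have h := inv_prod_le_of_gap (Finset.Icc 1 k) (d := fun j => ‖diskPoint b r ε j - a‖ / 2)
      (t := fun j => lineDist a (angle j ε) / 2) hη0 hη1 (fun j _ => half_pos (hpos j))
      (fun j _ => by have := lineDist_angle_le a r ε j; linarith) ?_
    · refine h.trans ?_
      have hηi : 1 ≤ η⁻¹ := (one_le_inv₀ hη0).2 hη1
      have h1 : ∑ j ∈ Finset.Icc 1 k, (lineDist a (angle j ε) / 2)⁻¹ ≤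
          2 * ∑ j ∈ Finset.Icc 1 K, (lineDist a (angle j ε))⁻¹ := by
        rw [Finset.mul_sum]
        simp_rw [inv_div, div_eq_mul_inv]
        exact Finset.sum_le_sum_of_subset_of_nonneg (Finset.Icc_subset_Icc_right hk)
          fun j _ _ => by have := hpos j; positivity
      have h2 : η⁻¹ ^ (Finset.Icc 1 k).card ≤ η⁻¹ ^ K :=
        pow_le_pow_right₀ hηi (by simpa using hk)
      rw [mul_assoc]
      have h3 : 0 ≤ ∑ j ∈ Finset.Icc 1 k, (lineDist a (angle j ε) / 2)⁻¹ :=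
        Finset.sum_nonneg fun j _ => by have := hpos j; positivity
      gcongr
      linarith
    · intro i _ j _ hij
      rcases lt_or_gt_of_ne hij with h | h
      · exact hgap _ _ (norm_diskPoint_le_sq hb hr' ε h)
      · exact (hgap _ _ (norm_diskPoint_le_sq hb hr' ε h)).symm

/-- The size of the singularities met by the first `K` points of the orbit. -/
noncomputable def singularSum (Z : Finset ℂ) (K : ℕ) (ε : BiSeq b) : ℝ :=
  1 + ∑ a ∈ Z, ∑ j ∈ Finset.Icc 1 K, (lineDist a (angle j ε))⁻¹

lemma one_le_singularSum (Z : Finset ℂ) (K : ℕ) (ε : BiSeq b) : 1 ≤ singularSum Z K ε := by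
  have : 0 ≤ ∑ a ∈ Z, ∑ j ∈ Finset.Icc 1 K, (lineDist a (angle j ε))⁻¹ :=
    Finset.sum_nonneg fun a _ => Finset.sum_nonneg fun j _ => inv_nonneg.2 (lineDist_nonneg _ _)
  unfold singularSum
  linarith

lemma exists_orbit_bounds (hb : 2 ≤ b) {B : ℂ → ℂ} (hc : ContinuousOn B (Metric.closedBall 0 1))
    (hd : DifferentiableOn ℂ B (Metric.ball 0 1))
    (hne : ∀ z ∈ Metric.sphere (0 : ℂ) 1, B z ≠ 0) :
    ∃ M : ℕ, ∃ Z : Finset ℂ,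
      (∀ r ∈ Ioc (0 : ℝ) 1, ∀ ε : BiSeq b, (∀ a ∈ Z, a ≠ 0 → ∀ j, lineDist a (angle j ε) ≠ 0) →
        ∀ k, B (diskPoint b r ε k) ≠ 0) ∧
      ∀ K : ℕ, ∀ δ > 0, ∃ C : ℝ, 0 ≤ C ∧ ∀ r ∈ Icc δ 1, ∀ ε : BiSeq b,
        (∀ a ∈ Z, a ≠ 0 → ∀ j, lineDist a (angle j ε) ≠ 0) → ∀ k ≤ K,
          (∏ j ∈ Finset.Icc 1 k, ‖B (diskPoint b r ε j)‖)⁻¹ ≤ C * singularSum Z K ε ^ M := by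
  obtain ⟨c, hc0, m, Z, hZ, hB⟩ := exists_lower_bound hc hd hne
  have hdist : ∀ r ∈ Ioc (0 : ℝ) 1, ∀ ε : BiSeq b,
      (∀ a ∈ Z, a ≠ 0 → ∀ j, lineDist a (angle j ε) ≠ 0) → ∀ k, ∀ a ∈ Z,
        0 < ‖diskPoint b r ε k - a‖ := by
    intro r hr ε hε k a ha
    by_cases ha0 : a = 0
    · subst ha0
      rw [sub_zero]
      exact hr.1.trans_le (le_norm_diskPoint' hb hr.1 ⟨le_rfl, hr.2⟩ ε k)
    · exact ((lineDist_nonneg _ _).lt_of_ne' (hε a ha ha0 k)).trans_le (lineDist_angle_le a r ε k)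
  refine ⟨m * Z.card, Z, ?_, ?_⟩
  · intro r hr ε hε k
    rw [← norm_pos_iff]
    refine lt_of_lt_of_le ?_ (hB _ (diskPoint_mem_closedBall b hr ε k))
    exact mul_pos hc0 (Finset.prod_pos fun a ha => by have := hdist r hr ε hε k a ha; positivity)
  · intro K δ hδ
    choose! E hE0 hE using fun a (ha : a ∈ Z) => exists_inv_prod_dist_le hb (hZ a ha) K hδ
    set c' := max 1 c⁻¹ with hc'
    refine ⟨c' ^ K * ∏ a ∈ Z, E a ^ m, mul_nonneg (by positivity)
      (Finset.prod_nonneg fun a ha => pow_nonneg (hE0 a ha) _), fun r hr ε hε k hk => ?_⟩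
    have hr' : r ∈ Ioc (0 : ℝ) 1 := ⟨hδ.trans_le hr.1, hr.2⟩
    have h1 : c ^ k * ∏ a ∈ Z, (∏ j ∈ Finset.Icc 1 k, ‖diskPoint b r ε j - a‖ / 2) ^ m ≤
        ∏ j ∈ Finset.Icc 1 k, ‖B (diskPoint b r ε j)‖ := by
      calc _ = ∏ j ∈ Finset.Icc 1 k, (c * ∏ a ∈ Z, (‖diskPoint b r ε j - a‖ / 2) ^ m) := by
            rw [Finset.prod_mul_distrib, Finset.prod_const, Finset.prod_comm]
            simp [Finset.prod_pow]
        _ ≤ _ := Finset.prod_le_prod (fun j _ => by positivity)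
            fun j _ => hB _ (diskPoint_mem_closedBall b hr' ε j)
    have h2 : 0 < ∏ a ∈ Z, (∏ j ∈ Finset.Icc 1 k, ‖diskPoint b r ε j - a‖ / 2) ^ m :=
      Finset.prod_pos fun a ha => pow_pos (Finset.prod_pos fun j _ =>
        half_pos (hdist r hr' ε hε j a ha)) _
    refine (inv_anti₀ (by positivity) h1).trans ?_
    rw [mul_inv, ← inv_pow, ← Finset.prod_inv_distrib, mul_assoc]
    have h3 : c⁻¹ ^ k ≤ c' ^ K :=
      (pow_le_pow_left₀ (inv_nonneg.2 hc0.le) (le_max_right _ _) k).trans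
        (pow_le_pow_right₀ (le_max_left _ _) hk)
    have hsing : ∀ a ∈ Z, 1 + ∑ j ∈ Finset.Icc 1 K, (lineDist a (angle j ε))⁻¹ ≤
        singularSum Z K ε := by
      intro a ha
      unfold singularSum
      gcongr
      exact Finset.single_le_sum (f := fun a => ∑ j ∈ Finset.Icc 1 K, (lineDist a (angle j ε))⁻¹)
        (fun a _ => Finset.sum_nonneg fun j _ => inv_nonneg.2 (lineDist_nonneg _ _)) ha
    have h4 : ∏ a ∈ Z, ((∏ j ∈ Finset.Icc 1 k, ‖diskPoint b r ε j - a‖ / 2) ^ m)⁻¹ ≤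
        (∏ a ∈ Z, E a ^ m) * singularSum Z K ε ^ (m * Z.card) := by
      rw [pow_mul, ← Finset.prod_const, ← Finset.prod_mul_distrib]
      refine Finset.prod_le_prod (fun a _ => by positivity) fun a ha => ?_
      rw [← inv_pow, ← mul_pow]
      refine pow_le_pow_left₀ (by positivity) ?_ m
      refine (hE a ha r hr ε (hε a ha) k hk).trans ?_
      exact mul_le_mul_of_nonneg_left (hsing a ha) (hE0 a ha)
    exact mul_le_mul h3 h4 (Finset.prod_nonneg fun a _ => by positivity) (by positivity)

/-- Near the unit circle, `log |B|` is almost independent of the radius. -/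
lemma exists_le_norm_near_circle (hb : 2 ≤ b) {B : ℂ → ℂ}
    (hc : ContinuousOn B (Metric.closedBall 0 1))
    (hne : ∀ z ∈ Metric.sphere (0 : ℂ) 1, B z ≠ 0) {η : ℝ} (hη : 0 < η) {δ : ℝ} (hδ : 0 < δ) :
    ∃ K : ℕ, ∀ r ∈ Icc δ 1, ∀ ε : BiSeq b, ∀ j > K,
      Real.exp (Real.log ‖B (circlePoint (angle j ε))‖ - η) ≤ ‖B (diskPoint b r ε j)‖ := by
  obtain ⟨w, hw, hmin⟩ := (isCompact_sphere (0 : ℂ) 1).exists_isMinOn ⟨1, by simp⟩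
    (hc.mono Metric.sphere_subset_closedBall).norm
  have hw0 : 0 < ‖B w‖ := norm_pos_iff.2 (hne w hw)
  have he : 0 < 1 - Real.exp (-η) := by
    have := Real.exp_lt_exp.2 (neg_lt_zero.2 hη)
    rw [Real.exp_zero] at this
    linarith
  -- An error of at most `1 - exp (-η)` times the minimum of `‖B‖` on the circle costs at most a
  -- factor `exp (-η)`.
  obtain ⟨s, hs, hu⟩ := Metric.uniformContinuousOn_iff.1
    ((isCompact_closedBall (0 : ℂ) 1).uniformContinuousOn_of_continuous hc)
    ((1 - Real.exp (-η)) * ‖B w‖) (by positivity)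
  have ht : Tendsto (fun k : ℕ => δ ^ (((b : ℝ) ^ k)⁻¹)) atTop (𝓝 1) := by
    have h1 : Tendsto (fun k : ℕ => ((b : ℝ) ^ k)⁻¹) atTop (𝓝 0) :=
      (tendsto_pow_atTop_atTop_of_one_lt (by exact_mod_cast (by omega : 1 < b))).inv_tendsto_atTop
    have h2 := (Real.continuousAt_const_rpow hδ.ne' (b := 0)).tendsto.comp h1
    rwa [Real.rpow_zero] at h2
  obtain ⟨K, hK⟩ := eventually_atTop.1 (ht.eventually (lt_mem_nhds (show 1 - s < 1 by linarith)))
  refine ⟨K, fun r hr ε j hj => ?_⟩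
  have hr' : r ∈ Ioc (0 : ℝ) 1 := ⟨hδ.trans_le hr.1, hr.2⟩
  have h1 := le_norm_diskPoint hδ hr ε j
  have h2 := hK j (le_of_lt hj)
  have hmem := diskPoint_mem_closedBall b hr' ε j
  have h3 : dist (diskPoint b r ε j) (circlePoint (angle j ε)) < s := by
    have e : diskPoint b r ε j - circlePoint (angle j ε) =
        (((r ^ (((b : ℝ) ^ j)⁻¹) - 1 : ℝ)) : ℂ) * circlePoint (angle j ε) := by
      rw [diskPoint_eq]
      push_cast
      rw [angle]
      ring
    rw [dist_eq_norm, e, norm_mul, norm_circlePoint, mul_one, Complex.norm_real, Real.norm_eq_abs]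
    rw [norm_diskPoint b hr'.1.le] at h1
    have h4 := mem_closedBall_zero_iff.1 hmem
    rw [norm_diskPoint b hr'.1.le] at h4
    rw [abs_lt]
    constructor <;> linarith
  have h4 := hu _ hmem _ (circlePoint_mem_closedBall _) h3
  have h5 : ‖B w‖ ≤ ‖B (circlePoint (angle j ε))‖ := hmin (circlePoint_mem_sphere _)
  have h6 : 0 < ‖B (circlePoint (angle j ε))‖ := hw0.trans_le h5
  rw [sub_eq_add_neg, Real.exp_add, Real.exp_log h6]
  rw [dist_eq_norm, norm_sub_rev] at h4
  have h7 := norm_sub_norm_le (B (circlePoint (angle j ε))) (B (diskPoint b r ε j))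
  nlinarith

end OrbitBound

/-! ### Moments of the terms of the series -/

lemma ennreal_rpow_tsum_le_tsum_rpow {ι : Type*} (a : ι → ℝ≥0∞) {κ : ℝ} (hκ0 : 0 < κ)
    (hκ1 : κ ≤ 1) : (∑' i, a i) ^ κ ≤ ∑' i, a i ^ κ := by
  classical
  rw [← ENNReal.le_rpow_inv_iff hκ0]
  refine ENNReal.summable.tsum_le_of_sum_le fun s => ?_
  rw [ENNReal.le_rpow_inv_iff hκ0]
  refine le_trans ?_ (ENNReal.sum_le_tsum s)
  induction s using Finset.induction_on with
  | empty => simp [hκ0]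
  | insert i s hi ih =>
    rw [Finset.sum_insert hi, Finset.sum_insert hi]
    exact (ENNReal.rpow_add_le_add_rpow _ _ hκ0.le hκ1).trans (by gcongr)

lemma rpow_one_add_sum_le {ι : Type*} (s : Finset ι) {a : ι → ℝ} (ha : ∀ i, 0 ≤ a i) {p : ℝ}
    (hp0 : 0 ≤ p) (hp1 : p ≤ 1) : (1 + ∑ i ∈ s, a i) ^ p ≤ 1 + ∑ i ∈ s, a i ^ p := by
  classical
  induction s using Finset.induction_on with
  | empty => simp
  | insert i s hi ih =>
    rw [Finset.sum_insert hi, Finset.sum_insert hi, add_left_comm, add_left_comm 1 (a i ^ p)]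
    have : 0 ≤ 1 + ∑ i ∈ s, a i := by
      have := Finset.sum_nonneg fun i (_ : i ∈ s) => ha i
      linarith
    exact (Real.rpow_add_le_add_rpow (ha i) this hp0 hp1).trans (by gcongr)

section

variable {b : ℕ}

lemma measurable_singularSum (Z : Finset ℂ) (K : ℕ) : Measurable (singularSum (b := b) Z K) := by
  unfold singularSum
  refine measurable_const.add (Finset.measurable_sum _ fun a _ => Finset.measurable_sum _
    fun j _ => ?_)
  exact ((continuous_lineDist a).measurable.comp (measurable_angle j)).inv

lemma singularSum_update (Z : Finset ℂ) {K : ℕ} {i : ℤ} (hi : i < -K) (ε : BiSeq b) (x : Fin b) :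
    singularSum Z K (Function.update ε i x) = singularSum Z K ε := by
  unfold singularSum
  congr 1
  refine Finset.sum_congr rfl fun a _ => Finset.sum_congr rfl fun j hj => ?_
  have := (Finset.mem_Icc.1 hj).2
  rw [angle_update_of_lt (by omega)]

lemma norm_seriesTerm (β h : ℂ → ℂ) (r : ℝ) (ε : BiSeq b) (k : ℕ) :
    ‖seriesTerm β h (solenoidPoint b r ε) k‖ =
      (∏ j ∈ Finset.Icc 1 k, ‖(β ∘ psiInv b) (diskPoint b r ε j)‖)⁻¹ *
        ‖(h ∘ psiInv b) (diskPoint b r ε k)‖ := by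
  simp [seriesTerm, backCocycle, solenoidPoint, norm_prod]

lemma inv_prod_le_of_near_circle {B : ℂ → ℂ} {r : ℝ} {ε : BiSeq b} {K : ℕ} {g : ℝ → ℝ} {Y : ℝ}
    (hY : ∀ k ≤ K, (∏ j ∈ Finset.Icc 1 k, ‖B (diskPoint b r ε j)‖)⁻¹ ≤ Y)
    (hnear : ∀ j > K, Real.exp (g (angle j ε)) ≤ ‖B (diskPoint b r ε j)‖) (k : ℕ) :
    (∏ j ∈ Finset.Icc 1 k, ‖B (diskPoint b r ε j)‖)⁻¹ ≤
      Y * Real.exp (-∑ i ∈ Finset.range (k - K), g (angle (K + i + 1) ε)) := by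
  by_cases hk : k ≤ K
  · simpa [Nat.sub_eq_zero_of_le hk] using hY k hk
  · obtain ⟨n, rfl⟩ := Nat.exists_eq_add_of_le (le_of_not_ge hk)
    rw [Nat.add_sub_cancel_left]
    clear hk
    induction n with
    | zero => simpa using hY K le_rfl
    | succ n ih =>
      rw [← add_assoc, Finset.prod_Icc_succ_top (by omega), mul_inv, Finset.sum_range_succ, neg_add,
        Real.exp_add, ← mul_assoc]
      have h1 := inv_anti₀ (Real.exp_pos _) (hnear (K + n + 1) (by omega))
      rw [← Real.exp_neg] at h1
      exact mul_le_mul ih h1 (by positivity) ((inv_nonneg.2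
        (Finset.prod_nonneg fun _ _ => norm_nonneg _)).trans ih)

variable [NeZero b]

lemma ae_angle_of_ae (hb : 2 ≤ b) {P : ℝ → Prop} (hP : ∀ᵐ θ : ℝ, P θ) (k : ℕ) :
    ∀ᵐ ε ∂(bernoulliMeasure b), P (angle k ε) := by
  have h : ∀ᵐ θ ∂((bernoulliMeasure b).map (angle k)), P θ := by
    rw [map_angle hb k]
    exact ae_restrict_of_ae hP
  exact ae_of_ae_map (measurable_angle k).aemeasurable h

lemma ae_lineDist_angle_ne_zero (hb : 2 ≤ b) (Z : Finset ℂ) :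
    ∀ᵐ ε ∂(bernoulliMeasure b), ∀ a ∈ Z, a ≠ 0 → ∀ j, lineDist a (angle j ε) ≠ 0 := by
  refine (ae_ball_iff Z.countable_toSet).2 fun a _ => ?_
  by_cases ha : a = 0
  · exact Eventually.of_forall fun ε h => absurd ha h
  · filter_upwards [ae_all_iff.2 fun j => ae_angle_of_ae hb (ae_lineDist_ne_zero ha) j] with ε h _
    exact h

lemma integrable_singularSum_rpow (hb : 2 ≤ b) (Z : Finset ℂ) (K : ℕ) {p : ℝ} (hp0 : 0 ≤ p)
    (hp1 : p < 1) : Integrable (fun ε => singularSum Z K ε ^ p) (bernoulliMeasure b) := by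
  have h1 : ∀ a : ℂ, ∀ j : ℕ, Integrable (fun ε => lineDist a (angle j ε) ^ (-p))
      (bernoulliMeasure b) := by
    intro a j
    have h := integrable_lineDist_rpow (a := a) hp0 hp1
    rw [← map_angle hb j] at h
    exact h.comp_measurable (measurable_angle j)
  have h2 : Integrable (fun ε => 1 + ∑ i ∈ Z ×ˢ Finset.Icc 1 K, lineDist i.1 (angle i.2 ε) ^ (-p))
      (bernoulliMeasure b) :=
    (integrable_const _).add (integrable_finsetSum _ fun i _ => h1 i.1 i.2)
  refine h2.mono' ((measurable_singularSum Z K).pow_const p).aestronglyMeasurable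
    (Eventually.of_forall fun ε => ?_)
  have h0 := one_le_singularSum Z K ε
  rw [Real.norm_eq_abs, abs_of_nonneg (by positivity), singularSum, ← Finset.sum_product']
  refine (rpow_one_add_sum_le _ (fun i => inv_nonneg.2 (lineDist_nonneg _ _)) hp0
    hp1.le).trans_eq ?_
  congr 1
  refine Finset.sum_congr rfl fun i _ => ?_
  rw [Real.inv_rpow (lineDist_nonneg _ _), Real.rpow_neg (lineDist_nonneg _ _)]

/-- Almost surely the denominators do not vanish, and small moments of the terms of the series are
dominated, uniformly in the radius, by a summable sequence. -/
lemma exists_majorant (hb : 2 ≤ b) {β : ℂ → ℂ} (hβ : DiffContOnCl ℂ β (Omega0 b))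
    (hβ0 : ∀ t ∈ frontier (Omega0 b), β t ≠ 0) (hχ : 0 < lyapunov b β) :
    (∀ᵐ ε ∂(bernoulliMeasure b), ∀ r ∈ Ioc (0 : ℝ) 1, ∀ k, β (solenoidPoint b r ε k) ≠ 0) ∧
    ∃ κ₀ : ℝ, 0 < κ₀ ∧ κ₀ ≤ 1 ∧ ∀ h : ℂ → ℂ, DiffContOnCl ℂ h (Omega0 b) →
      ∀ κ, 0 < κ → κ < κ₀ → ∀ δ > 0, ∃ R : ℕ → BiSeq b → ℝ≥0∞, (∀ k, Measurable (R k)) ∧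
        ∫⁻ ε, ∑' k, R k ε ∂(bernoulliMeasure b) ≠ ∞ ∧
        ∀ᵐ ε ∂(bernoulliMeasure b), ∀ r ∈ Icc δ 1, ∀ k,
          ‖seriesTerm β h (solenoidPoint b r ε) (k + 1)‖ₑ ^ κ ≤ R k ε := by
  have hφ := isInverseRiemannMap_psiInv hb
  set B : ℂ → ℂ := β ∘ psiInv b with hBdef
  have hc : ContinuousOn B (Metric.closedBall 0 1) := hφ.continuousOn_comp hβ
  have hd : DifferentiableOn ℂ B (Metric.ball 0 1) := hφ.differentiableOn_comp hβ
  have hne : ∀ z ∈ Metric.sphere (0 : ℂ) 1, B z ≠ 0 := fun z hz => hβ0 _ (hφ.mapsTo_frontier hz)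
  obtain ⟨M, Z, hM1, hM2⟩ := exists_orbit_bounds hb hc hd hne
  have hgood := ae_lineDist_angle_ne_zero hb Z
  refine ⟨?_, ?_⟩
  · filter_upwards [hgood] with ε hε r hr k
    exact hM1 r hr ε hε k
  set χ := lyapunov b β with hχdef
  have hlyap := lyapunov_eq hb hχ.ne'
  -- Half of the exponent pays for replacing the radius by `1`; the remaining mean is `χ / 2 > 0`.
  set g : ℝ → ℝ := fun θ => Real.log ‖B (circlePoint θ)‖ - χ / 2 with hg
  have hlogc : Continuous fun θ => Real.log ‖B (circlePoint θ)‖ := by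
    have : Continuous fun θ => B (circlePoint θ) :=
      hc.comp_continuous continuous_circlePoint circlePoint_mem_closedBall
    exact this.norm.log fun θ => norm_ne_zero_iff.2 (hne _ (circlePoint_mem_sphere θ))
  have hgc : Continuous g := hlogc.sub continuous_const
  have hgpos : 0 < ∫ x in (0 : ℝ)..1, g x := by
    have e : ∫ x in (0 : ℝ)..1, g x = χ - χ / 2 := by
      simp only [hg]
      rw [intervalIntegral.integral_sub (hlogc.intervalIntegrable _ _) (by simp),
        hχdef, hlyap]
      simp [hBdef]
    rw [e]
    linarith
  obtain ⟨v, hv, κ₁, hκ₁, hcontr⟩ := exists_exponential_contraction hb hgc hgpos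
  obtain ⟨V, hV⟩ := isCompact_Icc.exists_bound_of_continuousOn (hv.continuousOn (s := Icc (0 : ℝ) 1))
  have hV' : ∀ k, ∀ ε : BiSeq b, |v (angle k ε)| ≤ V := fun k ε => hV _ (angle_mem_Icc k ε)
  have hM0 : (0 : ℝ) < M + 1 := by positivity
  -- The second bound gives both `M * κ < 1`, for integrability of the singular factor, and `κ ≤ 1`,
  -- for subadditivity. Neither bound involves `h` or `δ`.
  refine ⟨min κ₁ (1 / (M + 1)), by positivity, (min_le_right _ _).trans (by
    rw [div_le_one hM0]; linarith [(Nat.cast_nonneg M : (0 : ℝ) ≤ M)]), ?_⟩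
  intro h hh κ hκ0 hκ δ hδ
  have hκM : M * κ < 1 := by
    have := hκ.trans_le (min_le_right _ _)
    rw [lt_div_iff₀ hM0] at this
    linarith
  have hκM0 : 0 ≤ M * κ := by positivity
  obtain ⟨q, hq0, hq1, hstep⟩ := hcontr κ hκ0 (hκ.trans_le (min_le_left _ _))
  obtain ⟨H, hH⟩ := (isCompact_closedBall (0 : ℂ) 1).exists_bound_of_continuousOn
    (hφ.continuousOn_comp hh)
  have hH0 : 0 ≤ H := (norm_nonneg _).trans (hH 0 (by simp))
  obtain ⟨K, hK⟩ := exists_le_norm_near_circle hb hc hne (half_pos hχ) hδ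
  obtain ⟨C, hC0, hC⟩ := hM2 K δ hδ
  set A : BiSeq b → ℝ≥0∞ := fun ε => ENNReal.ofReal (singularSum Z K ε ^ (M * κ)) with hA
  have hAm : Measurable A := ((measurable_singularSum Z K).pow_const _).ennreal_ofReal
  have hAfin : ∫⁻ ε, A ε ∂(bernoulliMeasure b) ≠ ∞ :=
    (integrable_singularSum_rpow hb Z K hκM0 hκM).lintegral_lt_top.ne
  set D : ℝ := (C * H) ^ κ * Real.exp (κ * V) with hD
  have hD0 : 0 ≤ D := by positivity
  set W : ℕ → BiSeq b → ℝ≥0∞ := fun n ε => A ε * ENNReal.ofReal (Real.exp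
    (∑ j ∈ Finset.range n, -κ * g (angle (K + j + 1) ε) + -κ * v (angle (K + n) ε))) with hW
  have hWm : ∀ n, Measurable (W n) := by
    intro n
    refine hAm.mul (Continuous.measurable ?_).ennreal_ofReal
    have := fun k => continuous_angle (b := b) k
    fun_prop
  have hWint : ∀ n, ∫⁻ ε, W n ε ∂(bernoulliMeasure b) ≤ ENNReal.ofReal (q ^ n) *
      (ENNReal.ofReal (Real.exp (κ * V)) * ∫⁻ ε, A ε ∂(bernoulliMeasure b)) := by
    intro n
    have := lintegral_mul_exp_sum_angle_le (K := K) (w := fun x => -κ * g x)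
      (v := fun x => -κ * v x) hAm (fun i hi ε x => by
        simp only [hA, singularSum_update Z hi]) (by fun_prop) (by fun_prop) hq0 hstep n
    refine this.trans ?_
    rw [ENNReal.ofReal_pow hq0, ← lintegral_const_mul' _ _ ENNReal.ofReal_ne_top]
    refine mul_le_mul' le_rfl (lintegral_mono fun ε => ?_)
    rw [mul_comm]
    refine mul_le_mul' (ENNReal.ofReal_le_ofReal (Real.exp_le_exp.2 ?_)) le_rfl
    have := (abs_le.1 (hV' K ε)).1
    nlinarith
  -- By truncated subtraction the terms of index at most `K` all use `W 0`. The factor `exp (κ * V)`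
  -- in `D` compensates the corrector inside `W`.
  refine ⟨fun k ε => ENNReal.ofReal D * W (k + 1 - K) ε, fun k => (hWm _).const_mul _, ?_, ?_⟩
  · rw [lintegral_tsum fun k => ((hWm _).const_mul _).aemeasurable]
    have hle : ∀ k, ∫⁻ ε, ENNReal.ofReal D * W (k + 1 - K) ε ∂(bernoulliMeasure b) ≤
        ENNReal.ofReal (q ^ (k + 1 - K)) * (ENNReal.ofReal D *
          (ENNReal.ofReal (Real.exp (κ * V)) * ∫⁻ ε, A ε ∂(bernoulliMeasure b))) := by
      intro k
      rw [lintegral_const_mul _ (hWm _), mul_left_comm]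
      gcongr
      exact hWint _
    refine ne_top_of_le_ne_top ?_ (ENNReal.tsum_le_tsum hle)
    rw [ENNReal.tsum_mul_right]
    refine ENNReal.mul_ne_top (Summable.tsum_ofReal_ne_top ?_) (ENNReal.mul_ne_top
      ENNReal.ofReal_ne_top (ENNReal.mul_ne_top ENNReal.ofReal_ne_top hAfin))
    rw [← summable_nat_add_iff K]
    have : ∀ k, k + K + 1 - K = k + 1 := fun k => by omega
    simp_rw [this]
    exact (summable_nat_add_iff 1).2 (summable_geometric_of_lt_one hq0 hq1)
  · filter_upwards [hgood] with ε hε r hr k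
    have hr' : r ∈ Ioc (0 : ℝ) 1 := ⟨hδ.trans_le hr.1, hr.2⟩
    have hY := one_le_singularSum Z K ε
    have h1 := inv_prod_le_of_near_circle (g := g) (hC r hr ε hε) (hK r hr ε) (k + 1)
    have h2 := hH _ (diskPoint_mem_closedBall b hr' ε (k + 1))
    set n := k + 1 - K with hn
    have h3 : ‖seriesTerm β h (solenoidPoint b r ε) (k + 1)‖ ≤ (C * H) * singularSum Z K ε ^ M *
        Real.exp (-∑ i ∈ Finset.range n, g (angle (K + i + 1) ε)) := by
      rw [norm_seriesTerm]
      calc _ ≤ (C * singularSum Z K ε ^ M *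
            Real.exp (-∑ i ∈ Finset.range n, g (angle (K + i + 1) ε))) * H := by
            gcongr
        _ = _ := by ring
    have h4 : ‖seriesTerm β h (solenoidPoint b r ε) (k + 1)‖ ^ κ ≤
        D * (singularSum Z K ε ^ (M * κ) * Real.exp (∑ j ∈ Finset.range n,
          -κ * g (angle (K + j + 1) ε) + -κ * v (angle (K + n) ε))) := by
      refine (Real.rpow_le_rpow (norm_nonneg _) h3 hκ0.le).trans ?_
      rw [Real.mul_rpow (by positivity) (Real.exp_pos _).le, Real.mul_rpow (by positivity)
        (by positivity), ← Real.rpow_natCast, ← Real.rpow_mul (by linarith), ← Real.exp_mul,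
        hD, Real.exp_add]
      have h5 : Real.exp (-(∑ i ∈ Finset.range n, g (angle (K + i + 1) ε)) * κ) =
          Real.exp (∑ j ∈ Finset.range n, -κ * g (angle (K + j + 1) ε)) := by
        rw [← Finset.mul_sum]
        ring_nf
      have h6 : 1 ≤ Real.exp (κ * V) * Real.exp (-κ * v (angle (K + n) ε)) := by
        rw [← Real.exp_add, Real.one_le_exp_iff]
        have := (abs_le.1 (hV' (K + n) ε)).2
        nlinarith
      rw [h5]
      have h7 : 0 ≤ (C * H) ^ κ * singularSum Z K ε ^ (M * κ) *
          Real.exp (∑ j ∈ Finset.range n, -κ * g (angle (K + j + 1) ε)) := by positivity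
      calc _ ≤ _ := le_mul_of_one_le_right h7 h6
        _ = _ := by ring
    rw [← ofReal_norm, ENNReal.ofReal_rpow_of_nonneg (norm_nonneg _) hκ0.le]
    refine (ENNReal.ofReal_le_ofReal h4).trans_eq ?_
    rw [ENNReal.ofReal_mul hD0]
    congr 1
    exact ENNReal.ofReal_mul (by positivity)

end

/-! ### Measurability, continuity in the radius and summation -/

section

variable {b : ℕ}

lemma continuous_diskPoint (r : ℝ) (k : ℕ) : Continuous fun ε : BiSeq b => diskPoint b r ε k :=
  continuous_const.mul (continuous_circlePoint.comp (continuous_angle k))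

lemma continuousOn_diskPoint_radius (hb : b ≠ 0) (ε : BiSeq b) (k : ℕ) (s : Set ℝ) :
    ContinuousOn (fun r => diskPoint b r ε k) s := by
  have h : Continuous fun r : ℝ => r ^ (((b : ℝ) ^ k)⁻¹) :=
    Real.continuous_rpow_const (by positivity)
  exact ((Complex.continuous_ofReal.comp h).mul continuous_const).continuousOn

lemma measurable_seriesTerm (hb : 2 ≤ b) {β h : ℂ → ℂ} (hβ : DiffContOnCl ℂ β (Omega0 b))
    (hh : DiffContOnCl ℂ h (Omega0 b)) {r : ℝ} (hr : r ∈ Ioc (0 : ℝ) 1) (k : ℕ) :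
    Measurable fun ε : BiSeq b => seriesTerm β h (solenoidPoint b r ε) k := by
  have hφ := isInverseRiemannMap_psiInv hb
  have H : ∀ {u : ℂ → ℂ}, DiffContOnCl ℂ u (Omega0 b) → ∀ j,
      Continuous fun ε : BiSeq b => u (solenoidPoint b r ε j) := fun hu j =>
    (hφ.continuousOn_comp hu).comp_continuous (continuous_diskPoint r j)
      fun ε => diskPoint_mem_closedBall b hr ε j
  exact (continuous_finsetProd _ fun j _ => H hβ j).measurable.inv.mul (H hh k).measurable

lemma continuousOn_seriesTerm_radius (hb : 2 ≤ b) {β h : ℂ → ℂ}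
    (hβ : DiffContOnCl ℂ β (Omega0 b)) (hh : DiffContOnCl ℂ h (Omega0 b)) {ε : BiSeq b}
    {s : Set ℝ} (hs : s ⊆ Ioc 0 1) (hne : ∀ r ∈ s, ∀ k, β (solenoidPoint b r ε k) ≠ 0) (k : ℕ) :
    ContinuousOn (fun r => seriesTerm β h (solenoidPoint b r ε) k) s := by
  have hφ := isInverseRiemannMap_psiInv hb
  have H : ∀ {u : ℂ → ℂ}, DiffContOnCl ℂ u (Omega0 b) → ∀ j,
      ContinuousOn (fun r => u (solenoidPoint b r ε j)) s := fun hu j =>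
    (hφ.continuousOn_comp hu).comp (continuousOn_diskPoint_radius (by omega) ε j s)
      fun r hr => diskPoint_mem_closedBall b (hs hr) ε j
  refine ContinuousOn.mul (ContinuousOn.inv₀ (continuousOn_finsetProd _ fun j _ => H hβ j) ?_)
    (H hh k)
  exact fun r hr => Finset.prod_ne_zero_iff.2 fun j _ => hne r hr j

/-- Subadditivity applied to `R k ^ κ⁻¹` turns a summable bound on `κ`-th powers into a Weierstrass
majorant. -/
lemma exists_summable_of_tsum_ne_top {R : ℕ → ℝ≥0∞} (hR : ∑' k, R k ≠ ∞) {κ : ℝ} (hκ0 : 0 < κ)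
    (hκ1 : κ ≤ 1) : ∃ u : ℕ → ℝ, Summable u ∧ ∀ x : ℂ, ∀ k, ‖x‖ₑ ^ κ ≤ R k → ‖x‖ ≤ u k := by
  have h1 : ∑' k, R k ^ κ⁻¹ ≠ ∞ := by
    have h2 := ennreal_rpow_tsum_le_tsum_rpow (fun k => R k ^ κ⁻¹) hκ0 hκ1
    simp_rw [ENNReal.rpow_inv_rpow hκ0.ne'] at h2
    intro h3
    rw [h3, ENNReal.top_rpow_of_pos hκ0] at h2
    exact hR (top_le_iff.1 h2)
  refine ⟨_, ENNReal.summable_toReal h1, fun x k hx => ?_⟩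
  rw [← toReal_enorm]
  exact ENNReal.toReal_mono (ENNReal.ne_top_of_tsum_ne_top h1 k)
    ((ENNReal.le_rpow_inv_iff hκ0).2 hx)

lemma enorm_G_rpow_le {β h : ℂ → ℂ} {z : ℕ → ℂ} {R : ℕ → ℝ≥0∞} {κ : ℝ} (hκ0 : 0 < κ)
    (hκ1 : κ ≤ 1) (hR : ∀ k, ‖seriesTerm β h z (k + 1)‖ₑ ^ κ ≤ R k) :
    ‖G β h z‖ₑ ^ κ ≤ ∑' k, R k := by
  rw [G, enorm_neg]
  calc _ ≤ (∑' k, ‖seriesTerm β h z (k + 1)‖ₑ) ^ κ :=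
        ENNReal.rpow_le_rpow enorm_tsum_le_tsum_enorm hκ0.le
    _ ≤ ∑' k, ‖seriesTerm β h z (k + 1)‖ₑ ^ κ := ennreal_rpow_tsum_le_tsum_rpow _ hκ0 hκ1
    _ ≤ _ := ENNReal.tsum_le_tsum hR

/-- Used with a countable dense set of radii, to make the uncountable supremum measurable. -/
lemma iSup_enorm_eq_of_dense {X : Type*} [TopologicalSpace X] {D : Set X} (hD : Dense D)
    {F : X → ℂ} (hF : Continuous F) : ⨆ x, ‖F x‖ₑ = ⨆ x ∈ D, ‖F x‖ₑ := by
  refine le_antisymm (iSup_le fun x => ?_) (iSup₂_le fun x _ => le_iSup (fun x => ‖F x‖ₑ) x)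
  have hcl : IsClosed {x | ‖F x‖ₑ ≤ ⨆ x ∈ D, ‖F x‖ₑ} := isClosed_le hF.enorm continuous_const
  have : closure D ⊆ {x | ‖F x‖ₑ ≤ ⨆ x ∈ D, ‖F x‖ₑ} :=
    hcl.closure_subset_iff.2 fun x hx => le_iSup₂ (f := fun x (_ : x ∈ D) => ‖F x‖ₑ) x hx
  exact this (hD x)

end

lemma memLp_ofReal_of_rpow_le {α E : Type*} [MeasurableSpace α] {μ : Measure α}
    [TopologicalSpace E] [ContinuousENorm E] {F : α → E} (hF : AEStronglyMeasurable F μ) {κ : ℝ}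
    (hκ : 0 < κ) {T : α → ℝ≥0∞} (hT : ∫⁻ x, T x ∂μ ≠ ∞) (hFT : ∀ᵐ x ∂μ, ‖F x‖ₑ ^ κ ≤ T x) :
    MemLp F (ENNReal.ofReal κ) μ := by
  refine ⟨hF, ?_⟩
  rw [eLpNorm_lt_top_iff_lintegral_rpow_enorm_lt_top (by simpa) ENNReal.ofReal_ne_top,
    ENNReal.toReal_ofReal hκ.le]
  exact (lintegral_mono_ae hFT).trans_lt hT.lt_top

end HierarchicalIsing

/-! ### The main technical lemma -/

open HierarchicalIsing in
theorem lemma6p2 (b : ℕ) (hb : 2 ≤ b) (β : ℂ → ℂ)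
    (hβ : DiffContOnCl ℂ β (Omega0 b))
    (hβ0 : ∀ t ∈ frontier (Omega0 b), β t ≠ 0)
    (hχ : 0 < lyapunov b β) :
    -- the coded points lie in the natural extension
    (∀ r ∈ Set.Ioc (0 : ℝ) 1, ∀ ε : BiSeq b, solenoidPoint b r ε ∈ naturalExtension b) ∧
    ∃ κ₀ : ℝ, 0 < κ₀ ∧
      ∀ h : ℂ → ℂ, DiffContOnCl ℂ h (Omega0 b) →
        -- almost everywhere, the series defining `G` makes sense and converges for all `r`
        (∀ᵐ ε ∂(bernoulliMeasure b), ∀ r ∈ Set.Ioc (0 : ℝ) 1,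
          (∀ k : ℕ, 1 ≤ k → β (solenoidPoint b r ε k) ≠ 0) ∧
          Summable (fun k : ℕ => seriesTerm β h (solenoidPoint b r ε) (k + 1))) ∧
        ∀ κ : ℝ, 0 < κ → κ < κ₀ →
          (∀ r ∈ Set.Ioc (0 : ℝ) 1,
            MeasureTheory.MemLp (fun ε : BiSeq b => G β h (solenoidPoint b r ε))
              (ENNReal.ofReal κ) (bernoulliMeasure b)) ∧
          (∀ δ : ℝ, 0 < δ →
            MeasureTheory.MemLp (supG b β h δ) (ENNReal.ofReal κ) (bernoulliMeasure b)) := by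
  have : NeZero b := ⟨by omega⟩
  refine ⟨fun r hr ε => solenoidPoint_mem_naturalExtension hb hr ε, ?_⟩
  obtain ⟨hne, κ₀, hκ₀, hκ₀1, hmaj⟩ := exists_majorant hb hβ hβ0 hχ
  refine ⟨κ₀, hκ₀, fun h hh => ?_⟩
  have hsum : ∀ κ, 0 < κ → κ < κ₀ → ∀ δ > 0, ∀ᵐ ε ∂(bernoulliMeasure b),
      ∃ u : ℕ → ℝ, Summable u ∧ ∀ r ∈ Icc δ 1, ∀ k,
        ‖seriesTerm β h (solenoidPoint b r ε) (k + 1)‖ ≤ u k := by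
    intro κ hκ0 hκ δ hδ
    obtain ⟨R, hRm, hRi, hR⟩ := hmaj h hh κ hκ0 hκ δ hδ
    filter_upwards [ae_lt_top (Measurable.tsum hRm) hRi, hR] with ε hε hRε
    obtain ⟨u, hu, hu'⟩ := exists_summable_of_tsum_ne_top hε.ne hκ0 (hκ.le.trans hκ₀1)
    exact ⟨u, hu, fun r hr k => hu' _ k (hRε r hr k)⟩
  have hconv : ∀ᵐ ε ∂(bernoulliMeasure b), ∀ r ∈ Ioc (0 : ℝ) 1,
      Summable (fun k : ℕ => seriesTerm β h (solenoidPoint b r ε) (k + 1)) := by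
    -- Countably many values of `δ` exhaust `(0,1]`, so a single null set serves all radii.
    have hall := ae_all_iff.2 fun n : ℕ =>
      hsum (κ₀ / 2) (half_pos hκ₀) (half_lt_self hκ₀) (1 / ((n : ℝ) + 1)) (by positivity)
    filter_upwards [hall] with ε hε r hr
    obtain ⟨n, hn⟩ := exists_nat_one_div_lt hr.1
    obtain ⟨u, hu, hu'⟩ := hε n
    exact Summable.of_norm_bounded hu fun k => hu' r ⟨hn.le, hr.2⟩ k
  have hmeas : ∀ r ∈ Ioc (0 : ℝ) 1, AEStronglyMeasurable
      (fun ε : BiSeq b => G β h (solenoidPoint b r ε)) (bernoulliMeasure b) := by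
    intro r hr
    refine AEStronglyMeasurable.neg (aestronglyMeasurable_of_tendsto_ae atTop
      (f := fun n ε => ∑ k ∈ Finset.range n, seriesTerm β h (solenoidPoint b r ε) (k + 1))
      (fun n => ?_) ?_)
    · exact (Finset.measurable_sum _ fun k _ =>
        measurable_seriesTerm hb hβ hh hr (k + 1)).aestronglyMeasurable
    · filter_upwards [hconv] with ε hε
      exact (hε r hr).hasSum.tendsto_sum_nat
  refine ⟨?_, fun κ hκ0 hκ => ⟨fun r hr => ?_, fun δ hδ => ?_⟩⟩
  · filter_upwards [hne, hconv] with ε h1 h2 r hr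
    exact ⟨fun k _ => h1 r hr k, h2 r hr⟩
  · obtain ⟨R, hRm, hRi, hR⟩ := hmaj h hh κ hκ0 hκ r hr.1
    refine memLp_ofReal_of_rpow_le (hmeas r hr) hκ0 hRi ?_
    filter_upwards [hR] with ε hε
    exact enorm_G_rpow_le hκ0 (hκ.le.trans hκ₀1) (hε r ⟨le_rfl, hr.2⟩)
  · obtain ⟨R, hRm, hRi, hR⟩ := hmaj h hh κ hκ0 hκ δ hδ
    have hsub : Icc δ 1 ⊆ Ioc (0 : ℝ) 1 := fun r hr => ⟨hδ.trans_le hr.1, hr.2⟩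
    refine memLp_ofReal_of_rpow_le (AEMeasurable.aestronglyMeasurable ?_) hκ0 hRi ?_
    · obtain ⟨D, hDc, hD⟩ := TopologicalSpace.exists_countable_dense (Icc δ 1)
      have hm : AEMeasurable (fun ε => ⨆ r ∈ D, ‖G β h (solenoidPoint b (r : ℝ) ε)‖ₑ)
          (bernoulliMeasure b) :=
        AEMeasurable.biSup D hDc fun r _ => (hmeas r (hsub r.2)).enorm
      refine hm.congr ?_
      filter_upwards [hne, hsum κ hκ0 hκ δ hδ] with ε h1 ⟨u, hu, hu'⟩
      -- The majorant is uniform in `r`, so almost surely `G` is continuous in `r` and its supremum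
      -- is attained along the countable set `D`.
      have hcont : ContinuousOn (fun r => G β h (solenoidPoint b r ε)) (Icc δ 1) :=
        (continuousOn_tsum (fun k => continuousOn_seriesTerm_radius hb hβ hh hsub
          (fun r hr => h1 r (hsub hr)) (k + 1)) hu fun k r hr => hu' r hr k).neg
      exact (iSup_enorm_eq_of_dense hD hcont.domRestrict).symm.trans iSup_subtype
    · filter_upwards [hR] with ε hε
      rw [enorm_eq_self, supG, ← ENNReal.le_rpow_inv_iff hκ0]
      refine iSup₂_le fun r hr => ?_
      rw [ENNReal.le_rpow_inv_iff hκ0]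
      exact enorm_G_rpow_le hκ0 (hκ.le.trans hκ₀1) (hε r hr)
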